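/- Let $P\in\mathbb{R}[x]$ be a monic polynomial of degree $2g+1$ or $2g+2$ with pairwise distinct complex roots, not all of them real, and let $X$ be the compact (hyperelliptic) Riemann surface of genus $g$ defined by $y^2=P(x)$, with the degree two covering $\pi\colon X\to\widehat{\mathbb C}=\mathbb{C}\cup\{\infty\}$, $(x,y)\mapsto x$. The branch points of $\pi$ are the roots of $P$, together with $\infty$ (which counts as real) if $\deg P=2g+1$. Let $2k$ be the number of real branch points and assume $k\ge 1$. Let $\tau\colon X\to X$ be a symmetry (an anti-holomorphic involution) induced by complex conjugation, i.e. $\pi(\tau(p))=\overline{\pi(p)}$ for all $p\in X$. The map $\tau$ acts on divisors by $\tau(\sum a_i x_i)=\sum a_i\tau(x_i)$. 1. A $2$-spin structure on $X$ is a linear equivalence class of divisors $D$ with $2D\sim K_X$, where $K_X$ is a canonical divisor; it is fixed by $\tau$ if $\tau(D)\sim D$. Exactly $2^{g+k-1}$ of the $2$-spin structures on $X$ are fixed by $\tau$. 2. Let $J_2$ be the $2$-torsion subgroup of the Jacobian $\mathrm{Jac}(X)=\mathrm{Div}_0(X)/\mathrm{PDiv}(X)$ and $J_2^\tau$ the subgroup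 of classes $[D]\in J_2$ with $\tau(D)\sim D$. Then $J_2^\tau\cong \mathbb{Z}_2^{\,g+k-1}$. 3. The Klein surface $X/\langle\tau\rangle$ has exactly $2^{g+k-1}$ $2$-spin structures. Here a $2$-spin structure on $X/\langle\tau\rangle$ is an isomorphism class of pairs $(L,\beta)$, where $L=\mathcal{O}(D)$ is the holomorphic line bundle of a divisor $D$ with $2D\sim K_X$ and $\beta$ is an anti-holomorphic, fibrewise anti-linear involution of $L$ covering $\tau$; an isomorphism of pairs is a holomorphic isomorphism of line bundles over the identity of $X$ that intertwines the involutions. -/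

import Mathlib

open Polynomial Topology
open scoped Manifold ContDiff

namespace HyperellipticSpin

/-- The affine plane curve `y² = P(x)` over `ℂ`, with the subspace topology. -/
abbrev AffineHyperelliptic (P : ℂ[X]) : Type := {p : ℂ × ℂ // p.2 ^ 2 = P.eval p.1}

/-- Near a point `a` with `P'(a) ≠ 0`, the polynomial function `P` is a homeomorphism between open
sets; the source is shrunk so that `P'` has no zero on it. -/
noncomputable def polyLocalInverse (P : ℂ[X]) (a : ℂ) (ha : P.derivative.eval a ≠ 0) :
    OpenPartialHomeomorph ℂ ℂ :=
  (((P.hasStrictDerivAt a).hasStrictFDerivAt_equiv ha).toOpenPartialHomeomorph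
    (fun x => P.eval x)).restrOpen {x | P.derivative.eval x ≠ 0}
      (isOpen_ne.preimage P.derivative.continuous)

theorem polyLocalInverse_coe (P : ℂ[X]) (a : ℂ) (ha : P.derivative.eval a ≠ 0) (x : ℂ) :
    polyLocalInverse P a ha x = P.eval x := rfl

theorem mem_polyLocalInverse_source (P : ℂ[X]) (a : ℂ) (ha : P.derivative.eval a ≠ 0) :
    a ∈ (polyLocalInverse P a ha).source := 
  ⟨HasStrictFDerivAt.mem_toOpenPartialHomeomorph_source _, ha⟩

theorem polyLocalInverse_deriv (P : ℂ[X]) (a : ℂ) (ha : P.derivative.eval a ≠ 0) {x : ℂ}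
    (hx : x ∈ (polyLocalInverse P a ha).source) : P.derivative.eval x ≠ 0 := hx.2

theorem polyLocalInverse_symm_differentiableAt (P : ℂ[X]) (a : ℂ)
    (ha : P.derivative.eval a ≠ 0) {z : ℂ} (hz : z ∈ (polyLocalInverse P a ha).target) :
    DifferentiableAt ℂ (polyLocalInverse P a ha).symm z :=
  ((polyLocalInverse P a ha).hasDerivAt_symm hz
    (polyLocalInverse_deriv P a ha ((polyLocalInverse P a ha).map_target hz))
    (P.hasDerivAt _)).differentiableAt

theorem derivative_sq_ne {b : ℂ} (hb : b ≠ 0) : (derivative (X ^ 2 : ℂ[X])).eval b ≠ 0 := by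
  simpa using hb

open Classical in
/-- The chart `(x, y) ↦ x` of `y² = P(x)` near points with `y`-coordinate close to `b ≠ 0`; its
inverse is `x ↦ (x, √P(x))` with the branch of the square root that is close to `b`. -/
noncomputable def chartX (P : ℂ[X]) (b : ℂ) (hb : b ≠ 0)
    (p₀ : AffineHyperelliptic P) :
    OpenPartialHomeomorph (AffineHyperelliptic P) ℂ :=
  let e := polyLocalInverse (X ^ 2) b (derivative_sq_ne hb)
  have he : ∀ y, e y = y ^ 2 := fun y => by simp [e, polyLocalInverse_coe]
  have hsym : ∀ z, P.eval z ∈ e.target → (e.symm (P.eval z)) ^ 2 = P.eval z := fun z hz => by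
    rw [← he, e.right_inv hz]
  { toFun := fun p => p.1.1
    invFun := fun x => if h : P.eval x ∈ e.target
      then ⟨(x, e.symm (P.eval x)), hsym x h⟩
      else p₀
    source := {p | p.1.2 ∈ e.source}
    target := {x | P.eval x ∈ e.target}
    map_source' := fun p hp => by
      have := e.map_source hp
      rw [he, p.2] at this
      exact this
    map_target' := fun x hx => by
      have hx' : P.eval x ∈ e.target := hx
      simp only [dif_pos hx']
      exact e.map_target hx
    left_inv' := fun p hp => by
      have h := e.map_source hp
      rw [he, p.2] at h
      have h2 := e.left_inv hp
      rw [he, p.2] at h2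
      simp only [dif_pos h]
      apply Subtype.ext
      exact Prod.ext rfl h2
    right_inv' := fun x hx => by
      have hx' : P.eval x ∈ e.target := hx
      simp only [dif_pos hx']
    open_source := e.open_source.preimage (by fun_prop)
    open_target := e.open_target.preimage P.continuous
    continuousOn_toFun := by fun_prop
    continuousOn_invFun := by
      refine Topology.IsInducing.subtypeVal.continuousOn_iff.2 ?_
      have : ContinuousOn (fun x : ℂ => (x, e.symm (P.eval x))) {x | P.eval x ∈ e.target} :=
        continuousOn_id.prodMk (e.continuousOn_symm.comp P.continuous.continuousOn fun x hx => hx)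
      refine this.congr fun x hx => ?_
      have hx' : P.eval x ∈ e.target := hx
      simp only [Function.comp, dif_pos hx'] }

open Classical in
/-- The chart `(x, y) ↦ y` of `y² = P(x)` near points with `x`-coordinate close to `a`, where
`P'(a) ≠ 0`; its inverse is `y ↦ (P⁻¹(y²), y)` with the local inverse of `P` near `a`. -/
noncomputable def chartY (P : ℂ[X]) (a : ℂ) (ha : P.derivative.eval a ≠ 0)
    (p₀ : AffineHyperelliptic P) :
    OpenPartialHomeomorph (AffineHyperelliptic P) ℂ :=
  let e := polyLocalInverse P a ha
  have hsym : ∀ y : ℂ, y ^ 2 ∈ e.target → y ^ 2 = P.eval (e.symm (y ^ 2)) := fun z hz => by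
    rw [← polyLocalInverse_coe P a ha, e.right_inv hz]
  { toFun := fun p => p.1.2
    invFun := fun y => if h : y ^ 2 ∈ e.target
      then ⟨(e.symm (y ^ 2), y), hsym y h⟩ else p₀
    source := {p | p.1.1 ∈ e.source}
    target := {y | y ^ 2 ∈ e.target}
    map_source' := fun p hp => by
      have := e.map_source hp
      rw [polyLocalInverse_coe, ← p.2] at this
      exact this
    map_target' := fun x hx => by
      have hx' : x ^ 2 ∈ e.target := hx
      simp only [dif_pos hx']
      exact e.map_target hx
    left_inv' := fun p hp => by
      have h := e.map_source hp
      rw [polyLocalInverse_coe, ← p.2] at h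
      have h2 := e.left_inv hp
      rw [polyLocalInverse_coe, ← p.2] at h2
      simp only [dif_pos h]
      apply Subtype.ext
      exact Prod.ext h2 rfl
    right_inv' := fun x hx => by
      have hx' : x ^ 2 ∈ e.target := hx
      simp only [dif_pos hx']
    open_source := e.open_source.preimage (by fun_prop)
    open_target := e.open_target.preimage (by fun_prop)
    continuousOn_toFun := by fun_prop
    continuousOn_invFun := by
      refine Topology.IsInducing.subtypeVal.continuousOn_iff.2 ?_
      have : ContinuousOn (fun y : ℂ => (e.symm (y ^ 2), y)) {y | y ^ 2 ∈ e.target} :=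
        (e.continuousOn_symm.comp (g := e.symm) (f := fun y : ℂ => y ^ 2)
          (continuous_pow 2).continuousOn fun x hx => hx).prodMk continuousOn_id
      refine this.congr fun x hx => ?_
      have hx' : x ^ 2 ∈ e.target := hx
      simp only [Function.comp, dif_pos hx'] }

open Classical in
/-- The chart at a smooth point `p = (a, b)` of `y² = P(x)`: the coordinate `x` if `b ≠ 0`,
the coordinate `y` if `b = 0`. -/
noncomputable def affineChart (P : ℂ[X]) (p : AffineHyperelliptic P)
    (h : p.1.2 = 0 → P.derivative.eval p.1.1 ≠ 0) :
    OpenPartialHomeomorph (AffineHyperelliptic P) ℂ :=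
  if hb : p.1.2 = 0 then chartY P p.1.1 (h hb) p else chartX P p.1.2 hb p

theorem mem_affineChart_source (P : ℂ[X]) (p : AffineHyperelliptic P)
    (h : p.1.2 = 0 → P.derivative.eval p.1.1 ≠ 0) : p ∈ (affineChart P p h).source := by
  unfold affineChart
  split_ifs with hb
  · exact mem_polyLocalInverse_source P p.1.1 (h hb)
  · exact mem_polyLocalInverse_source (X ^ 2) p.1.2 (derivative_sq_ne hb)

theorem affineChart_coe (P : ℂ[X]) (p : AffineHyperelliptic P)
    (h : p.1.2 = 0 → P.derivative.eval p.1.1 ≠ 0) :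
    (∀ q, affineChart P p h q = q.1.1) ∨ (∀ q, affineChart P p h q = q.1.2) := by
  unfold affineChart
  split_ifs with hb
  · exact Or.inr fun _ => rfl
  · exact Or.inl fun _ => rfl

open Classical in
theorem affineChart_symm (P : ℂ[X]) (p : AffineHyperelliptic P)
    (h : p.1.2 = 0 → P.derivative.eval p.1.1 ≠ 0) :
    DifferentiableOn ℂ (fun z => ((affineChart P p h).symm z).1) (affineChart P p h).target := by
  unfold affineChart
  split_ifs with hb
  · have : DifferentiableOn ℂ (fun y : ℂ => ((polyLocalInverse P p.1.1 (h hb)).symm (y ^ 2), y))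
        {y | y ^ 2 ∈ (polyLocalInverse P p.1.1 (h hb)).target} := fun y hy =>
      ((polyLocalInverse_symm_differentiableAt P p.1.1 (h hb) hy).comp (f := fun y : ℂ => y ^ 2) y
        (by fun_prop)).prodMk differentiableAt_id |>.differentiableWithinAt
    refine this.congr fun y hy => ?_
    have hy' : y ^ 2 ∈ (polyLocalInverse P p.1.1 (h hb)).target := hy
    exact congrArg Subtype.val (dif_pos hy')
  · have : DifferentiableOn ℂ (fun x : ℂ => (x, (polyLocalInverse (X ^ 2) p.1.2
          (derivative_sq_ne hb)).symm (P.eval x)))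
        {x | P.eval x ∈ (polyLocalInverse (X ^ 2) p.1.2 (derivative_sq_ne hb)).target} :=
      fun x hx => (differentiableAt_id.prodMk
        ((polyLocalInverse_symm_differentiableAt (X ^ 2) p.1.2 (derivative_sq_ne hb) hx).comp
          (f := fun x : ℂ => P.eval x) x P.differentiableAt)).differentiableWithinAt
    refine this.congr fun x hx => ?_
    have hx' : P.eval x ∈ (polyLocalInverse (X ^ 2) p.1.2 (derivative_sq_ne hb)).target := hx
    exact congrArg Subtype.val (dif_pos hx')


/-- The equation `y² = P(x)` with `P` monic with pairwise distinct roots, of degree `2g + 1` or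
`2g + 2`. -/
structure HyperellipticEquation (g : ℕ) where
  poly : ℂ[X]
  monic : poly.Monic
  squarefree : Squarefree poly
  natDegree_eq : poly.natDegree = 2 * g + 1 ∨ poly.natDegree = 2 * g + 2

namespace HyperellipticEquation

variable {g : ℕ} (C : HyperellipticEquation g)

/-- `t^(2g+2) P(1/t)`, the right-hand side of the equation `w² = t^(2g+2) P(1/t)` of the surface
in the coordinates `t = 1/x`, `w = y / x^(g+1)` near infinity. -/
noncomputable def revPoly : ℂ[X] := C.poly.reflect (2 * g + 2)

theorem natDegree_le : C.poly.natDegree ≤ 2 * g + 2 := by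
  rcases C.natDegree_eq with h | h <;> omega

theorem revPoly_eval {t : ℂ} (ht : t ≠ 0) :
    C.revPoly.eval t = t ^ (2 * g + 2) * C.poly.eval t⁻¹ := by
  have : Invertible t⁻¹ := invertibleOfNonzero (inv_ne_zero ht)
  have h := eval₂_reflect_mul_pow (RingHom.id ℂ) t⁻¹ (2 * g + 2) C.poly C.natDegree_le
  simp only [invOf_eq_inv, inv_inv, eval₂_id] at h
  rw [revPoly, ← h, inv_pow]
  field_simp

theorem derivative_ne {a : ℂ} (h : C.poly.eval a = 0) : C.poly.derivative.eval a ≠ 0 := by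
  have hs : C.poly.Separable := PerfectField.separable_iff_squarefree.2 C.squarefree
  intro h'
  obtain ⟨u, v, huv⟩ := hs
  have := congrArg (Polynomial.eval a) huv
  simp [h, h'] at this

theorem revPoly_derivative_ne (h : C.revPoly.eval 0 = 0) : C.revPoly.derivative.eval 0 ≠ 0 := by
  rw [← coeff_zero_eq_eval_zero] at h ⊢
  rw [revPoly, coeff_reflect, revAt_le (Nat.zero_le _), Nat.sub_zero] at h
  rw [coeff_derivative, revPoly, coeff_reflect, revAt_le (by omega)]
  have hm := C.monic.coeff_natDegree
  rcases C.natDegree_eq with hd | hd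
  · rw [hd] at hm
    have : 2 * g + 2 - (0 + 1) = 2 * g + 1 := by omega
    rw [this, hm]
    simp
  · rw [hd] at hm
    rw [hm] at h
    exact absurd h one_ne_zero

/-- The affine part `y² = P(x)`. -/
abbrev AffinePart : Type := AffineHyperelliptic C.poly

/-- The part `w² = t^(2g+2) P(1/t)`. -/
abbrev InfinityPart : Type := AffineHyperelliptic C.revPoly

/-- The points of the compact surface of `y² = P(x)`: the points of the affine curve, and over
`x = ∞` the points with `t = 0` of the curve `w² = t^(2g+2) P(1/t)` (one point if `P` has odd
degree, two if it has even degree). -/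
inductive Surface : Type
  | affine (p : C.AffinePart) : Surface
  | infinity (w : {w : ℂ // w ^ 2 = C.revPoly.eval 0}) : Surface

open Classical in
/-- The gluing map of the second affine curve: `(t, w) ↦ (x, y) = (1/t, w / t^(g+1))` for
`t ≠ 0`. -/
noncomputable def ofInfinityPart (q : C.InfinityPart) : C.Surface :=
  if h : q.1.1 = 0 then .infinity ⟨q.1.2, by rw [q.2, h]⟩
  else .affine ⟨(q.1.1⁻¹, q.1.2 / q.1.1 ^ (g + 1)), by
    have h2 := q.2
    rw [C.revPoly_eval h] at h2
    simp only [div_pow, h2]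
    field_simp
    ring⟩

theorem ofInfinityPart_injective : Function.Injective C.ofInfinityPart := by
  rintro ⟨⟨t, w⟩, h⟩ ⟨⟨t', w'⟩, h'⟩ e
  unfold ofInfinityPart at e
  by_cases ht : t = 0 <;> by_cases ht' : t' = 0
  · simp_all
  · simp_all
  · simp_all
  · simp only [ht, ht', dite_false, Surface.affine.injEq, Subtype.mk.injEq, Prod.mk.injEq,
      inv_inj] at e
    obtain ⟨rfl, e⟩ := e
    rw [div_left_inj' (pow_ne_zero _ ht)] at e
    simp [e]

/-- The surface is glued from the two affine curves: a set is open if and only if its traces on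
both are open. -/
noncomputable instance : TopologicalSpace C.Surface :=
  TopologicalSpace.coinduced Surface.affine inferInstance ⊔
    TopologicalSpace.coinduced C.ofInfinityPart inferInstance

theorem isOpen_iff (U : Set C.Surface) :
    IsOpen U ↔ IsOpen (Surface.affine ⁻¹' U) ∧ IsOpen (C.ofInfinityPart ⁻¹' U) := Iff.rfl

theorem isOpenEmbedding_affine : IsOpenEmbedding (Surface.affine : C.AffinePart → C.Surface) := by
  refine .of_continuous_injective_isOpenMap ?_ (fun p q h => by simpa using h) ?_
  · exact continuous_def.2 fun U hU => ((C.isOpen_iff U).1 hU).1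
  · intro U hU
    refine (C.isOpen_iff _).2 ⟨?_, ?_⟩
    · rwa [Set.preimage_image_eq _ (fun p q h => by simpa using h)]
    · obtain ⟨V, hV, rfl⟩ := isOpen_induced_iff.1 hU
      have hc : ContinuousOn (fun q : C.InfinityPart => (q.1.1⁻¹, q.1.2 / q.1.1 ^ (g + 1)))
          {q | q.1.1 ≠ 0} := by
        have h1 : ContinuousOn (fun q : C.InfinityPart => q.1.1) {q | q.1.1 ≠ 0} := by fun_prop
        have h2 : ContinuousOn (fun q : C.InfinityPart => q.1.2) {q | q.1.1 ≠ 0} := by fun_prop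
        exact (h1.inv₀ fun q hq => hq).prodMk
          (h2.div (h1.pow _) fun q hq => pow_ne_zero _ hq)
      have ho : IsOpen {q : C.InfinityPart | q.1.1 ≠ 0} :=
        isOpen_ne.preimage (f := fun q : C.InfinityPart => q.1.1) (by fun_prop)
      convert hc.isOpen_inter_preimage ho hV using 1
      ext q
      by_cases hq : q.1.1 = 0 <;> simp [ofInfinityPart, hq]

theorem isOpenEmbedding_ofInfinityPart : IsOpenEmbedding C.ofInfinityPart := by
  refine .of_continuous_injective_isOpenMap ?_ C.ofInfinityPart_injective ?_
  · exact continuous_def.2 fun U hU => ((C.isOpen_iff U).1 hU).2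
  · intro U hU
    refine (C.isOpen_iff _).2 ⟨?_, ?_⟩
    · obtain ⟨V, hV, rfl⟩ := isOpen_induced_iff.1 hU
      have hc : ContinuousOn (fun p : C.AffinePart => (p.1.1⁻¹, p.1.2 / p.1.1 ^ (g + 1)))
          {p | p.1.1 ≠ 0} := by
        have h1 : ContinuousOn (fun q : C.AffinePart => q.1.1) {q | q.1.1 ≠ 0} := by fun_prop
        have h2 : ContinuousOn (fun q : C.AffinePart => q.1.2) {q | q.1.1 ≠ 0} := by fun_prop
        exact (h1.inv₀ fun q hq => hq).prodMk
          (h2.div (h1.pow _) fun q hq => pow_ne_zero _ hq)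
      have ho : IsOpen {q : C.AffinePart | q.1.1 ≠ 0} :=
        isOpen_ne.preimage (f := fun q : C.AffinePart => q.1.1) (by fun_prop)
      convert hc.isOpen_inter_preimage ho hV using 1
      ext ⟨⟨x, y⟩, hxy⟩
      simp only [Set.mem_preimage, Set.mem_image, Set.mem_inter_iff, Set.mem_ofPred_eq]
      constructor
      · rintro ⟨⟨⟨t, w⟩, hq⟩, hV, e⟩
        by_cases ht : t = 0
        · simp [ofInfinityPart, ht] at e
        · simp only [ofInfinityPart, ht, dite_false, Surface.affine.injEq, Subtype.mk.injEq,
            Prod.mk.injEq] at e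
          obtain ⟨rfl, rfl⟩ := e
          refine ⟨inv_ne_zero ht, ?_⟩
          have : w / t ^ (g + 1) / t⁻¹ ^ (g + 1) = w := by
            rw [inv_pow]
            field_simp
          simpa only [inv_inv, this] using hV
      · rintro ⟨hx, hV⟩
        refine ⟨⟨(x⁻¹, y / x ^ (g + 1)), ?_⟩, hV, ?_⟩
        · rw [C.revPoly_eval (inv_ne_zero hx)]
          simp only at hxy
          simp only [inv_inv, inv_pow, div_pow, hxy]
          field_simp
          ring
        · have : y / x ^ (g + 1) / x⁻¹ ^ (g + 1) = y := by
            rw [inv_pow]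
            field_simp
          simp [ofInfinityPart, hx]
    · rwa [Set.preimage_image_eq _ C.ofInfinityPart_injective]

theorem smooth_affine (p : C.AffinePart) (h : p.1.2 = 0) : C.poly.derivative.eval p.1.1 ≠ 0 :=
  C.derivative_ne (by rw [← p.2, h]; simp)

theorem smooth_infinity (w : {w : ℂ // w ^ 2 = C.revPoly.eval 0}) (h : w.1 = 0) :
    C.revPoly.derivative.eval 0 ≠ 0 :=
  C.revPoly_derivative_ne (by rw [← w.2, h]; simp)

/-- The chart at a point: at an affine point the coordinate `x`, or `y` where `y = 0`; over
`x = ∞` the coordinate `t = 1/x`, or `w = y / x^(g+1)` where `w = 0`. -/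
noncomputable def chart : C.Surface → OpenPartialHomeomorph C.Surface ℂ
  | .affine p =>
      haveI : Nonempty C.AffinePart := ⟨p⟩
      (C.isOpenEmbedding_affine.toOpenPartialHomeomorph _).symm.trans
        (affineChart C.poly p (C.smooth_affine p))
  | .infinity w =>
      haveI : Nonempty C.InfinityPart := ⟨⟨(0, w.1), w.2⟩⟩
      (C.isOpenEmbedding_ofInfinityPart.toOpenPartialHomeomorph _).symm.trans
        (affineChart C.revPoly ⟨(0, w.1), w.2⟩ (C.smooth_infinity w))

theorem ofInfinityPart_zero (w : {w : ℂ // w ^ 2 = C.revPoly.eval 0}) :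
    C.ofInfinityPart ⟨(0, w.1), w.2⟩ = .infinity w := by
  simp [ofInfinityPart]

theorem mem_chart_source (p : C.Surface) : p ∈ (C.chart p).source := by
  cases p with
  | affine p =>
    have : Nonempty C.AffinePart := ⟨p⟩
    simp only [chart, OpenPartialHomeomorph.trans_source, OpenPartialHomeomorph.symm_source]
    refine ⟨⟨p, trivial, rfl⟩, ?_⟩
    rw [Set.mem_preimage, IsOpenEmbedding.toOpenPartialHomeomorph_left_inv]
    exact mem_affineChart_source _ _ _
  | infinity w =>
    have : Nonempty C.InfinityPart := ⟨⟨(0, w.1), w.2⟩⟩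
    simp only [chart, OpenPartialHomeomorph.trans_source, OpenPartialHomeomorph.symm_source]
    refine ⟨⟨⟨(0, w.1), w.2⟩, trivial, C.ofInfinityPart_zero w⟩, ?_⟩
    rw [Set.mem_preimage, ← C.ofInfinityPart_zero w,
      IsOpenEmbedding.toOpenPartialHomeomorph_left_inv]
    exact mem_affineChart_source _ _ _

noncomputable instance : ChartedSpace ℂ C.Surface where
  atlas := Set.range C.chart
  chartAt := C.chart
  mem_chart_source := C.mem_chart_source
  chart_mem_atlas p := ⟨p, rfl⟩

/-- The affine coordinates `(x, y)` of a point, with a junk value over `x = ∞`. -/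
noncomputable def xy : C.Surface → ℂ × ℂ
  | .affine p => p.1
  | .infinity _ => 0

/-- The coordinates `(t, w) = (1/x, y / x^(g+1))` of a point, with a junk value over `x = 0`. -/
noncomputable def tw : C.Surface → ℂ × ℂ
  | .affine p => (p.1.1⁻¹, p.1.2 / p.1.1 ^ (g + 1))
  | .infinity w => (0, w.1)

theorem tw_ofInfinityPart (q : C.InfinityPart) : C.tw (C.ofInfinityPart q) = q.1 := by
  obtain ⟨⟨t, w⟩, h⟩ := q
  by_cases ht : t = 0
  · simp [ofInfinityPart, ht, tw]
  · have : w / t ^ (g + 1) / t⁻¹ ^ (g + 1) = w := by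
      rw [inv_pow]
      field_simp
    simp only [ofInfinityPart, ht, tw, dite_false, inv_inv, this]

theorem xy_ofInfinityPart (q : C.InfinityPart) (h : q.1.1 ≠ 0) :
    C.xy (C.ofInfinityPart q) = (q.1.1⁻¹, q.1.2 / q.1.1 ^ (g + 1)) := by
  simp [ofInfinityPart, h, xy]

theorem chart_symm (p : C.Surface) :
    (∃ s : ℂ → C.AffinePart, (∀ z, (C.chart p).symm z = .affine (s z)) ∧
      DifferentiableOn ℂ (fun z => (s z).1) (C.chart p).target) ∨
    (∃ s : ℂ → C.InfinityPart, (∀ z, (C.chart p).symm z = C.ofInfinityPart (s z)) ∧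
      DifferentiableOn ℂ (fun z => (s z).1) (C.chart p).target) := by
  cases p with
  | affine p =>
    exact Or.inl ⟨_, fun z => rfl, (affineChart_symm _ _ _).mono fun z hz => hz.1⟩
  | infinity w =>
    exact Or.inr ⟨_, fun z => rfl, (affineChart_symm _ _ _).mono fun z hz => hz.1⟩

theorem chart_coe (p : C.Surface) :
    ((C.chart p).source ⊆ Set.range Surface.affine ∧
      ((∀ q ∈ (C.chart p).source, C.chart p q = (C.xy q).1) ∨
       (∀ q ∈ (C.chart p).source, C.chart p q = (C.xy q).2))) ∨
    ((C.chart p).source ⊆ Set.range C.ofInfinityPart ∧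
      ((∀ q ∈ (C.chart p).source, C.chart p q = (C.tw q).1) ∨
       (∀ q ∈ (C.chart p).source, C.chart p q = (C.tw q).2))) := by
  cases p with
  | affine p =>
    have : Nonempty C.AffinePart := ⟨p⟩
    have hs : (C.chart (.affine p)).source ⊆ Set.range Surface.affine := by
      rintro _ ⟨⟨q, _, rfl⟩, _⟩
      exact ⟨q, rfl⟩
    have key : ∀ q, C.chart (.affine p) (.affine q) =
        affineChart C.poly p (C.smooth_affine p) q := fun q =>
      congrArg _ (IsOpenEmbedding.toOpenPartialHomeomorph_left_inv _ C.isOpenEmbedding_affine)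
    refine Or.inl ⟨hs, ?_⟩
    refine (affineChart_coe C.poly p (C.smooth_affine p)).imp (fun h q hq => ?_) fun h q hq => ?_
    all_goals
      obtain ⟨q, rfl⟩ := hs hq
      rw [key, h, xy]
  | infinity w =>
    have : Nonempty C.InfinityPart := ⟨⟨(0, w.1), w.2⟩⟩
    have hs : (C.chart (.infinity w)).source ⊆ Set.range C.ofInfinityPart := by
      rintro _ ⟨⟨q, _, rfl⟩, _⟩
      exact ⟨q, rfl⟩
    have key : ∀ q, C.chart (.infinity w) (C.ofInfinityPart q) =
        affineChart C.revPoly ⟨(0, w.1), w.2⟩ (C.smooth_infinity w) q := fun q =>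
      congrArg _ (IsOpenEmbedding.toOpenPartialHomeomorph_left_inv _
        C.isOpenEmbedding_ofInfinityPart)
    refine Or.inr ⟨hs, ?_⟩
    refine (affineChart_coe C.revPoly ⟨(0, w.1), w.2⟩ (C.smooth_infinity w)).imp (fun h q hq => ?_) fun h q hq => ?_
    all_goals
      obtain ⟨q, rfl⟩ := hs hq
      rw [key, h, tw_ofInfinityPart]

theorem xy_chart_symm (p : C.Surface) :
    DifferentiableOn ℂ (fun z => C.xy ((C.chart p).symm z))
      ((C.chart p).target ∩ (C.chart p).symm ⁻¹' Set.range Surface.affine) := by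
  rcases C.chart_symm p with ⟨s, hs, hd⟩ | ⟨s, hs, hd⟩
  · simp only [hs, xy]
    exact hd.mono Set.inter_subset_left
  · have hne : ∀ z ∈ (C.chart p).target ∩ (C.chart p).symm ⁻¹' Set.range Surface.affine,
        (s z).1.1 ≠ 0 := by
      rintro z ⟨_, a, ha⟩ h0
      rw [hs] at ha
      simp [ofInfinityPart, h0] at ha
    have hd' := hd.mono (Set.inter_subset_left
      (t := (C.chart p).symm ⁻¹' Set.range (Surface.affine (C := C))))
    refine DifferentiableOn.congr (f := fun z => ((s z).1.1⁻¹, (s z).1.2 / (s z).1.1 ^ (g + 1)))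
      ?_ fun z hz => ?_
    · exact (hd'.fst.inv hne).prodMk
        (hd'.snd.div (hd'.fst.pow _) fun z hz => pow_ne_zero _ (hne z hz))
    · rw [hs, C.xy_ofInfinityPart _ (hne z hz)]

theorem tw_chart_symm (p : C.Surface) :
    DifferentiableOn ℂ (fun z => C.tw ((C.chart p).symm z))
      ((C.chart p).target ∩ (C.chart p).symm ⁻¹' Set.range C.ofInfinityPart) := by
  rcases C.chart_symm p with ⟨s, hs, hd⟩ | ⟨s, hs, hd⟩
  · have hne : ∀ z ∈ (C.chart p).target ∩ (C.chart p).symm ⁻¹' Set.range C.ofInfinityPart,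
        (s z).1.1 ≠ 0 := by
      rintro z ⟨_, q, hq⟩ h0
      rw [hs, ofInfinityPart] at hq
      split_ifs at hq with h
      rw [Surface.affine.injEq] at hq
      rw [← hq] at h0
      exact inv_ne_zero h h0
    have hd' := hd.mono (Set.inter_subset_left
      (t := (C.chart p).symm ⁻¹' Set.range C.ofInfinityPart))
    refine DifferentiableOn.congr (f := fun z => ((s z).1.1⁻¹, (s z).1.2 / (s z).1.1 ^ (g + 1)))
      ?_ fun z hz => by rw [hs, tw]
    exact (hd'.fst.inv hne).prodMk
      (hd'.snd.div (hd'.fst.pow _) fun z hz => pow_ne_zero _ (hne z hz))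
  · simp only [hs, tw_ofInfinityPart]
    exact hd.mono Set.inter_subset_left

/-- The charts make the surface a complex analytic manifold of dimension one. -/
instance : IsManifold 𝓘(ℂ, ℂ) ω C.Surface := by
  refine isManifold_of_contDiffOn 𝓘(ℂ, ℂ) ω C.Surface ?_
  rintro _ _ ⟨p, rfl⟩ ⟨q, rfl⟩
  simp only [modelWithCornersSelf_coe, modelWithCornersSelf_coe_symm, Set.range_id,
    Set.preimage_id, Set.inter_univ, Function.id_comp, Function.comp_id]
  refine DifferentiableOn.contDiffOn ?_ (OpenPartialHomeomorph.open_source _)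
  have hsrc : ∀ z ∈ ((C.chart p).symm.trans (C.chart q)).source,
      z ∈ (C.chart p).target ∧ (C.chart p).symm z ∈ (C.chart q).source := fun z hz => hz
  rcases C.chart_coe q with ⟨hs, h | h⟩ | ⟨hs, h | h⟩
  · exact ((C.xy_chart_symm p).mono fun z hz => ⟨(hsrc z hz).1, hs (hsrc z hz).2⟩).fst.congr
      fun z hz => h _ (hsrc z hz).2
  · exact ((C.xy_chart_symm p).mono fun z hz => ⟨(hsrc z hz).1, hs (hsrc z hz).2⟩).snd.congr
      fun z hz => h _ (hsrc z hz).2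
  · exact ((C.tw_chart_symm p).mono fun z hz => ⟨(hsrc z hz).1, hs (hsrc z hz).2⟩).fst.congr
      fun z hz => h _ (hsrc z hz).2
  · exact ((C.tw_chart_symm p).mono fun z hz => ⟨(hsrc z hz).1, hs (hsrc z hz).2⟩).snd.congr
      fun z hz => h _ (hsrc z hz).2

/-- The degree two covering `π : (x, y) ↦ x` of the Riemann sphere. -/
noncomputable def proj : C.Surface → OnePoint ℂ
  | .affine p => (p.1.1 : OnePoint ℂ)
  | .infinity _ => OnePoint.infty

/-- The branch points of `π`: the roots of `P`, and `∞` if `P` has odd degree `2g + 1`. -/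
def branchPoints : Set (OnePoint ℂ) :=
  {e | (∃ z : ℂ, C.poly.IsRoot z ∧ e = (z : OnePoint ℂ)) ∨
    (e = OnePoint.infty ∧ C.poly.natDegree = 2 * g + 1)}

end HyperellipticEquation

section RiemannSurface

variable {X : Type*} [TopologicalSpace X] [ChartedSpace ℂ X]

/-- Meromorphic functions on a Riemann surface, as functions that are meromorphic in the charts;
the values at poles are irrelevant. -/
def IsMeromorphicFun (h : X → ℂ) : Prop :=
  ∀ p : X, MeromorphicAt (h ∘ (chartAt ℂ p).symm) (chartAt ℂ p p)

/-- The order of vanishing at `p` (negative at poles, `⊤` if the function vanishes near `p`). -/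
noncomputable def orderAt (h : X → ℂ) (p : X) : WithTop ℤ :=
  meromorphicOrderAt (h ∘ (chartAt ℂ p).symm) (chartAt ℂ p p)

/-- Divisors on a compact Riemann surface. -/
abbrev Divisor (X : Type*) : Type _ := X →₀ ℤ

/-- `h` is a meromorphic function, not vanishing identically, with divisor `D`. -/
def HasDivisor (h : X → ℂ) (D : Divisor X) : Prop :=
  IsMeromorphicFun h ∧ ∀ p, orderAt h p = (D p : WithTop ℤ)

variable (X) in
/-- The group of principal divisors. -/
def principalDivisors : AddSubgroup (Divisor X) where
  carrier := {D | ∃ h : X → ℂ, HasDivisor h D}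
  zero_mem' := by
    refine ⟨fun _ => 1, fun p => MeromorphicAt.const 1 _, fun p => ?_⟩
    exact (meromorphicOrderAt_const (chartAt ℂ p p) (1 : ℂ)).trans (by simp)
  add_mem' := by
    rintro D E ⟨h, hm, ho⟩ ⟨k, km, ko⟩
    refine ⟨h * k, fun p => (hm p).mul (km p), fun p => ?_⟩
    refine (meromorphicOrderAt_mul (hm p) (km p)).trans ?_
    rw [Finsupp.add_apply, WithTop.coe_add, ← ho, ← ko]
    rfl
  neg_mem' := by
    rintro D ⟨h, hm, ho⟩
    refine ⟨h⁻¹, fun p => (hm p).inv, fun p => ?_⟩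
    refine (meromorphicOrderAt_inv (f := h ∘ (chartAt ℂ p).symm)).trans ?_
    have := ho p
    unfold orderAt at this
    rw [this, Finsupp.neg_apply]
    rfl

/-- Linear equivalence of divisors. -/
def LinEquiv (D E : Divisor X) : Prop := D - E ∈ principalDivisors X

/-- The coefficient, in the chart at `p`, of a section `η` of the holomorphic cotangent bundle. -/
noncomputable def formCoeff (η : ∀ q : X, TangentSpace 𝓘(ℂ, ℂ) q →L[ℂ] ℂ) (p : X) (z : ℂ) : ℂ :=
  η ((chartAt ℂ p).symm z) (mfderiv 𝓘(ℂ, ℂ) 𝓘(ℂ, ℂ) (chartAt ℂ p).symm z (1 : ℂ))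

/-- A canonical divisor: the divisor of a meromorphic one-form that does not vanish identically
(the values of the form at its poles are irrelevant). -/
def IsCanonical (K : Divisor X) : Prop :=
  ∃ η : ∀ q : X, TangentSpace 𝓘(ℂ, ℂ) q →L[ℂ] ℂ, ∀ p : X,
    MeromorphicAt (formCoeff η p) (chartAt ℂ p p) ∧
      meromorphicOrderAt (formCoeff η p) (chartAt ℂ p p) = (K p : WithTop ℤ)

/-- An `m`-spin divisor: `m D` is linearly equivalent to a canonical divisor. -/
def IsSpinDivisor (m : ℕ) (D : Divisor X) : Prop :=
  ∃ K : Divisor X, IsCanonical K ∧ LinEquiv (m • D) K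

variable (X) in
/-- The group of divisor classes. -/
abbrev DivisorClass : Type _ := Divisor X ⧸ principalDivisors X

/-- The action `∑ aᵢ xᵢ ↦ ∑ aᵢ τ(xᵢ)` of a map on divisors. -/
noncomputable def divisorMap (τ : X → X) : Divisor X →+ Divisor X :=
  Finsupp.mapDomain.addMonoidHom τ

variable (X) in
/-- `m`-spin structures on `X`: classes of `m`-spin divisors up to linear equivalence. -/
def spinStructures (m : ℕ) : Set (DivisorClass X) :=
  {c | ∃ D : Divisor X, IsSpinDivisor m D ∧ (D : DivisorClass X) = c}

/-- The `m`-spin structures on `X` that are fixed by `τ`. -/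
def fixedSpinStructures (m : ℕ) (τ : X → X) : Set (DivisorClass X) :=
  {c ∈ spinStructures X m |
    ∃ D : Divisor X, (D : DivisorClass X) = c ∧ LinEquiv (divisorMap τ D) D}

variable (X) in
/-- Divisors of degree zero. -/
noncomputable def degreeZeroDivisors : AddSubgroup (Divisor X) :=
  (Finsupp.degree : Divisor X →+ ℤ).ker

variable (X) in
/-- The Jacobian: degree zero divisors modulo linear equivalence. -/
abbrev Jacobian : Type _ :=
  degreeZeroDivisors X ⧸ (principalDivisors X).addSubgroupOf (degreeZeroDivisors X)

variable (X) in
/-- `J_m`, the `m`-torsion subgroup of the Jacobian. -/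
noncomputable def jacobianTorsion (m : ℕ) : AddSubgroup (Jacobian X) := (nsmulAddMonoidHom m).ker

/-- The classes in the Jacobian that are fixed by `τ`, i.e. the classes of the degree zero
divisors `D` with `τ(D)` linearly equivalent to `D`. -/
noncomputable def jacobianFixed (τ : X → X) : AddSubgroup (Jacobian X) :=
  ((principalDivisors X).comap ((divisorMap τ - AddMonoidHom.id _).comp
    (degreeZeroDivisors X).subtype)).map (QuotientAddGroup.mk' _)

/-- `J_m^τ`, the classes in `J_m` that are fixed by `τ`. -/
noncomputable def jacobianTorsionFixed (m : ℕ) (τ : X → X) : AddSubgroup (Jacobian X) :=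
  jacobianTorsion X m ⊓ jacobianFixed τ

/-- A symmetry of a Riemann surface: an anti-holomorphic involution. -/
structure IsSymmetry (τ : X → X) : Prop where
  involutive : Function.Involutive τ
  continuous : Continuous τ
  antiholomorphic : ∀ p : X, AnalyticAt ℂ
    (fun z => (starRingEnd ℂ) (chartAt ℂ (τ p) (τ ((chartAt ℂ p).symm z)))) (chartAt ℂ p p)

/-- An `m`-spin structure on the Klein surface `X / ⟨τ⟩`: a pair `(L, β)` of an `m`-spin bundle
`L = O(D)` on `X` and an anti-holomorphic involution `β` of `L` covering `τ`.

Meromorphic sections of `O(D)` are meromorphic functions `s`, with order `ord_p s + D(p)` at `p`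
as sections. An anti-holomorphic, fibrewise anti-linear bundle map `β` covering `τ` acts on them by
`s ↦ β ∘ s ∘ τ = h · conj (s ∘ τ)`, where `h` is the image of the section `1`. That `β` is regular
and bijective on fibres means that the order of `β ∘ s ∘ τ` at `p` is that of `s` at `τ p`,
i.e. `ord_p h = D(τ p) - D(p)`; that `β` is an involution means `h · conj (h ∘ τ) = 1`. -/
structure KleinSpinPair (m : ℕ) (τ : X → X) where
  D : Divisor X
  isSpin : IsSpinDivisor m D
  h : X → ℂ
  isMeromorphic : IsMeromorphicFun h
  order_eq : ∀ p, orderAt h p = ((D (τ p) - D p : ℤ) : WithTop ℤ)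
  involution : (fun p => h p * (starRingEnd ℂ) (h (τ p))) =ᶠ[Filter.codiscrete X] fun _ => 1

/-- Isomorphism of pairs: a holomorphic isomorphism `O(D) → O(D')`, i.e. multiplication `s ↦ u s`
by a meromorphic function `u` with divisor `D - D'`, that intertwines `β` and `β'`. -/
def KleinSpinPair.Iso {m : ℕ} {τ : X → X} (A B : KleinSpinPair m τ) : Prop :=
  ∃ u : X → ℂ, HasDivisor u (A.D - B.D) ∧
    (fun p => u p * A.h p) =ᶠ[Filter.codiscrete X] fun p => B.h p * (starRingEnd ℂ) (u (τ p))

/-- The `m`-spin structures on the Klein surface `X / ⟨τ⟩`: isomorphism classes of pairs. -/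
def KleinSpinStructures (m : ℕ) (τ : X → X) : Type _ :=
  Quot (KleinSpinPair.Iso : KleinSpinPair m τ → KleinSpinPair m τ → Prop)

end RiemannSurface

/-- Complex conjugation on the Riemann sphere. -/
noncomputable def conjSphere : OnePoint ℂ → OnePoint ℂ := OnePoint.map (starRingEnd ℂ)

end HyperellipticSpin

open HyperellipticSpin

namespace HyperellipticSpin

open Filter

/-! All three counts reduce to counting two-torsion divisor classes fixed by $\tau$, and these are
described by Weierstrass points, the fixed points of the hyperelliptic involution `flip`.

On the compact connected surface a meromorphic function with trivial divisor is constant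
(`HasDivisor.eq_const`), so a divisor determines its function up to a scalar. The functions $x-a$
and $y$ and the form $dx/y$ give the basic relations: all fibres of $\pi$ are equivalent, the sum of
the $2g+2$ Weierstrass points is equivalent to $g+1$ fibres, and $g-1$ fibres form a canonical
divisor. Since $D+\mathrm{flip}(D)\sim \deg(D)\cdot\text{fibre}$, principal divisors have degree
zero and `flip` acts as $-1$ on classes of degree zero.

A two-torsion class is therefore `flip`-invariant. A Hilbert 90 argument
(`exists_flip_eq_of_add_self`) finds an invariant divisor in it, and an invariant divisor is a
combination of fibres and Weierstrass points. So the two-torsion is generated by the classes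
$W-W_0$. The divisor of $y$ eliminates one further point $W_1$. The remaining $2g$ classes are
independent over $\mathbb F_2$: a function realizing a relation would be an eigenfunction of `flip`,
and the parity of its order at a Weierstrass point determines the eigenvalue
(`eq_neg_one_zpow_of_comp_flip`), with contradictory results at different points.

As $k\ge1$, both $W_0$ and $W_1$ can be chosen over real branch points, so they are fixed by $\tau$.
The $\tau$-fixed two-torsion classes then correspond to the $\tau$-stable subsets of the other $2g$
points, of which $2k-2$ are fixed. There are $(2g+2k-2)/2=g+k-1$ orbits, hence $2^{g+k-1}$ stable
subsets (`ncard_fixedTwoTorsion`).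

The fixed spin structures are a translate of this group by the $\tau$-fixed class $(g-1)W_0$. For
the Klein surface, a fixed class carries an involution $\beta$ because $\tau$ has a fixed point
(`exists_kleinSpinPair`), and $\beta$ is unique up to isomorphism because every complex number of
modulus one has a square root of modulus one (`KleinSpinPair.iso_of_linEquiv`). -/

theorem eventuallyEq_codiscrete_iff {X Y : Type*} [TopologicalSpace X] {f g : X → Y} :
    f =ᶠ[codiscrete X] g ↔ ∀ p, f =ᶠ[𝓝[≠] p] g := by
  simp only [EventuallyEq, Filter.Eventually, mem_codiscrete, disjoint_principal_right,
    compl_compl]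

/-! ### Meromorphic functions on a Riemann surface and their divisors -/

section RiemannSurface

variable {X : Type*} [TopologicalSpace X] [ChartedSpace ℂ X]

/-- This is the bridge between the surface and $\mathbb C$: orders and limits are defined in a
chart, while identities of functions are stated on punctured neighbourhoods in $X$. -/
theorem map_chartAt_symm_nhdsNE (p : X) :
    map (chartAt ℂ p).symm (𝓝[≠] (chartAt ℂ p p)) = 𝓝[≠] p := by
  have h1 := (chartAt ℂ p).symm.map_nhdsWithin_preimage_eq
    (mem_chart_target ℂ p) {p}ᶜ
  rw [(chartAt ℂ p).left_inv (mem_chart_source ℂ p)] at h1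
  rw [← h1]
  congr 1
  refine nhdsWithin_eq_nhdsWithin' ((chartAt ℂ p).open_target.mem_nhds (mem_chart_target ℂ p)) ?_
  ext z
  simp only [Set.mem_inter_iff, Set.mem_compl_iff, Set.mem_singleton_iff, Set.mem_preimage]
  refine and_congr_left fun hz => not_congr ⟨?_, ?_⟩
  · rintro rfl
    exact (chartAt ℂ p).left_inv (mem_chart_source ℂ p)
  · intro h
    have := (chartAt ℂ p).right_inv hz
    rw [h] at this
    exact this.symm

theorem eventually_chartAt_symm {p : X} {Q : X → Prop} :
    (∀ᶠ z in 𝓝[≠] (chartAt ℂ p p), Q ((chartAt ℂ p).symm z)) ↔ ∀ᶠ q in 𝓝[≠] p, Q q := by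
  rw [← map_chartAt_symm_nhdsNE p, eventually_map]

theorem tendsto_comp_chartAt_symm {p : X} {f : X → ℂ} {l : Filter ℂ} :
    Tendsto (f ∘ (chartAt ℂ p).symm) (𝓝[≠] (chartAt ℂ p p)) l ↔ Tendsto f (𝓝[≠] p) l := by
  rw [← map_chartAt_symm_nhdsNE p, tendsto_map'_iff]

/-- No point is isolated. Hence limits along punctured neighbourhoods are unique, and identities
valid near $p$ can be tested at an actual point. -/
instance nhdsNE_neBot (p : X) : NeBot (𝓝[≠] p) := by
  rw [← map_chartAt_symm_nhdsNE p]
  infer_instance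

theorem MeromorphicAt.comp_chartAt_congr {f g : X → ℂ} {p : X}
    (hf : MeromorphicAt (f ∘ (chartAt ℂ p).symm) (chartAt ℂ p p)) (h : f =ᶠ[𝓝[≠] p] g) :
    MeromorphicAt (g ∘ (chartAt ℂ p).symm) (chartAt ℂ p p) :=
  hf.congr (eventually_chartAt_symm (Q := fun q => f q = g q) |>.2 h)

theorem orderAt_congr {f g : X → ℂ} {p : X} (h : f =ᶠ[𝓝[≠] p] g) : orderAt f p = orderAt g p :=
  meromorphicOrderAt_congr (eventually_chartAt_symm (Q := fun q => f q = g q) |>.2 h)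

theorem orderAt_eq_top_iff {f : X → ℂ} {p : X} : orderAt f p = ⊤ ↔ ∀ᶠ q in 𝓝[≠] p, f q = 0 :=
  meromorphicOrderAt_eq_top_iff.trans (eventually_chartAt_symm (Q := fun q => f q = 0))

namespace IsMeromorphicFun

variable {f g : X → ℂ}

theorem congr (hf : IsMeromorphicFun f) (h : f =ᶠ[codiscrete X] g) : IsMeromorphicFun g :=
  fun p => MeromorphicAt.comp_chartAt_congr (hf p) (eventuallyEq_codiscrete_iff.1 h p)

theorem mul (hf : IsMeromorphicFun f) (hg : IsMeromorphicFun g) : IsMeromorphicFun (f * g) :=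
  fun p => (hf p).mul (hg p)

theorem add (hf : IsMeromorphicFun f) (hg : IsMeromorphicFun g) : IsMeromorphicFun (f + g) :=
  fun p => (hf p).add (hg p)

theorem inv (hf : IsMeromorphicFun f) : IsMeromorphicFun f⁻¹ :=
  fun p => (hf p).inv

theorem const (c : ℂ) : IsMeromorphicFun (fun _ : X => c) :=
  fun _ => MeromorphicAt.const c _

theorem orderAt_mul (hf : IsMeromorphicFun f) (hg : IsMeromorphicFun g) (p : X) :
    orderAt (f * g) p = orderAt f p + orderAt g p :=
  meromorphicOrderAt_mul (hf p) (hg p)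

theorem orderAt_ne_top_iff (hf : IsMeromorphicFun f) {p : X} :
    orderAt f p ≠ ⊤ ↔ ∀ᶠ q in 𝓝[≠] p, f q ≠ 0 :=
  (meromorphicOrderAt_ne_top_iff_eventually_ne_zero (hf p)).trans
    (eventually_chartAt_symm (Q := fun q => f q ≠ 0))

theorem orderAt_eq_zero_iff (hf : IsMeromorphicFun f) {p : X} :
    orderAt f p = 0 ↔ ∃ c ≠ 0, Tendsto f (𝓝[≠] p) (𝓝 c) := by
  rw [orderAt, ← tendsto_ne_zero_iff_meromorphicOrderAt_eq_zero (hf p)]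
  simp only [tendsto_comp_chartAt_symm]

theorem eventually_continuousAt (hf : IsMeromorphicFun f) (p : X) :
    ∀ᶠ q in 𝓝[≠] p, ContinuousAt f q := by
  have h := (hf p).eventually_continuousAt
  rw [← eventually_chartAt_symm]
  have ht : ∀ᶠ z in 𝓝[≠] (chartAt ℂ p p), z ∈ (chartAt ℂ p).target :=
    nhdsWithin_le_nhds ((chartAt ℂ p).open_target.mem_nhds (mem_chart_target ℂ p))
  filter_upwards [h, ht] with z hz hzt
  have h2 : ContinuousAt ((f ∘ (chartAt ℂ p).symm) ∘ chartAt ℂ p) ((chartAt ℂ p).symm z) := by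
    refine ContinuousAt.comp ?_ ((chartAt ℂ p).continuousAt ((chartAt ℂ p).map_target hzt))
    rwa [(chartAt ℂ p).right_inv hzt]
  refine h2.congr ?_
  filter_upwards [(chartAt ℂ p).open_source.mem_nhds ((chartAt ℂ p).map_target hzt)] with q hq
  simp [(chartAt ℂ p).left_inv hq]

theorem eventually_orderAt_eq_zero (hf : IsMeromorphicFun f) {p : X} (hp : orderAt f p ≠ ⊤) :
    ∀ᶠ q in 𝓝[≠] p, orderAt f q = 0 := by
  filter_upwards [hf.eventually_continuousAt p, hf.orderAt_ne_top_iff.1 hp] with q h1 h2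
  exact hf.orderAt_eq_zero_iff.2 ⟨f q, h2, h1.tendsto.mono_left nhdsWithin_le_nhds⟩

/-- The identity principle: near a point of finite order the function has order zero at all other
points, and near a point of infinite order it vanishes. -/
theorem isClopen_orderAt_eq_top [T1Space X] (hf : IsMeromorphicFun f) :
    IsClopen {p | orderAt f p = ⊤} := by
  constructor
  · rw [← isOpen_compl_iff, isOpen_iff_mem_nhds]
    intro p hp
    have h := hf.eventually_orderAt_eq_zero hp
    rw [eventually_nhdsWithin_iff] at h
    filter_upwards [h] with q hq
    by_cases hqp : q = p
    · rwa [hqp]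
    · simp [hq hqp]
  · rw [isOpen_iff_mem_nhds]
    intro p hp
    have h := eventually_nhdsNE_eventually_nhds_iff.2 (orderAt_eq_top_iff.1 hp)
    rw [eventually_nhdsWithin_iff] at h
    filter_upwards [h] with q hq
    by_cases hqp : q = p
    · rwa [hqp]
    · exact orderAt_eq_top_iff.2 ((hq hqp).filter_mono nhdsWithin_le_nhds)

theorem exists_hasDivisor [T1Space X] [CompactSpace X] [PreconnectedSpace X]
    (hf : IsMeromorphicFun f) {p : X} (hp : orderAt f p ≠ ⊤) : ∃ D, HasDivisor f D := by
  have hne : ∀ q, orderAt f q ≠ ⊤ := by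
    rcases isClopen_iff.1 hf.isClopen_orderAt_eq_top with h | h
    · intro q hq
      have : q ∈ {p | orderAt f p = ⊤} := hq
      rw [h] at this
      exact this
    · exact absurd (h ▸ Set.mem_univ p : p ∈ {p | orderAt f p = ⊤}) hp
  -- Infinitely many zeros and poles would accumulate by compactness, while near any point the order
  -- is zero off that point.
  have hfin : {q | orderAt f q ≠ 0}.Finite := by
    by_contra hinf
    obtain ⟨x, hx⟩ := Set.Infinite.exists_accPt_principal hinf
    rw [accPt_iff_frequently_nhdsNE] at hx
    exact hx ((hf.eventually_orderAt_eq_zero (hne x)).mono fun q hq h => h hq)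
  refine ⟨Finsupp.onFinset hfin.toFinset (fun q => (orderAt f q).untop₀) fun q hq => ?_, hf,
    fun q => ?_⟩
  · rw [Set.Finite.mem_toFinset]
    intro h0
    rw [h0] at hq
    exact hq rfl
  · rw [Finsupp.onFinset_apply, WithTop.coe_untop₀_of_ne_top (hne q)]

end IsMeromorphicFun

namespace HasDivisor

variable {f g : X → ℂ} {D E : Divisor X}

theorem congr (hf : HasDivisor f D) (h : f =ᶠ[codiscrete X] g) : HasDivisor g D :=
  ⟨hf.1.congr h, fun p => by
    rw [← hf.2, orderAt_congr (eventuallyEq_codiscrete_iff.1 h p)]⟩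

theorem mul (hf : HasDivisor f D) (hg : HasDivisor g E) : HasDivisor (f * g) (D + E) :=
  ⟨hf.1.mul hg.1, fun p => by
    rw [hf.1.orderAt_mul hg.1, hf.2, hg.2, Finsupp.add_apply, WithTop.coe_add]⟩

theorem inv (hf : HasDivisor f D) : HasDivisor f⁻¹ (-D) :=
  ⟨hf.1.inv, fun p => by
    have := hf.2 p
    rw [orderAt] at this ⊢
    refine (meromorphicOrderAt_inv (f := f ∘ (chartAt ℂ p).symm)).trans ?_
    rw [this, Finsupp.neg_apply]
    rfl⟩

theorem const {c : ℂ} (hc : c ≠ 0) : HasDivisor (fun _ : X => c) 0 :=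
  ⟨.const c, fun p => (meromorphicOrderAt_const (chartAt ℂ p p) c).trans (by simp [hc])⟩

theorem unique (hf : HasDivisor f D) (hf' : HasDivisor f E) : D = E :=
  Finsupp.ext fun p => WithTop.coe_injective ((hf.2 p).symm.trans (hf'.2 p))

theorem eventually_ne_zero (hf : HasDivisor f D) (p : X) : ∀ᶠ q in 𝓝[≠] p, f q ≠ 0 :=
  hf.1.orderAt_ne_top_iff.1 (by rw [hf.2]; exact WithTop.coe_ne_top)

theorem exists_tendsto (hf : HasDivisor f D) {p : X} (hp : D p = 0) :
    ∃ c ≠ 0, Tendsto f (𝓝[≠] p) (𝓝 c) :=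
  hf.1.orderAt_eq_zero_iff.1 (by rw [hf.2, hp]; rfl)

end HasDivisor

/-- A meromorphic function without poles on a compact connected Riemann surface is constant. -/
theorem IsMeromorphicFun.eq_const_of_orderAt_nonneg [T1Space X] [CompactSpace X]
    [PreconnectedSpace X] [IsManifold 𝓘(ℂ, ℂ) ω X] {f : X → ℂ} (hf : IsMeromorphicFun f)
    (h : ∀ p, 0 ≤ orderAt f p) : ∃ c : ℂ, f =ᶠ[codiscrete X] fun _ => c := by
  choose G hG hfG using fun p => ((hf p).meromorphicOrderAt_nonneg_iff).1 (h p)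
  have hfG' : ∀ p, ∀ᶠ q in 𝓝[≠] p, f q = G p (chartAt ℂ p q) := fun p => by
    rw [← eventually_chartAt_symm]
    have ht : ∀ᶠ z in 𝓝[≠] (chartAt ℂ p p), z ∈ (chartAt ℂ p).target :=
      nhdsWithin_le_nhds ((chartAt ℂ p).open_target.mem_nhds (mem_chart_target ℂ p))
    filter_upwards [hfG p, ht] with z hz hzt
    rw [(chartAt ℂ p).right_inv hzt, ← hz]
    rfl
  -- The values of `f` at isolated points are arbitrary. Taking the punctured limit everywhere fills
  -- in the removable singularities and gives a holomorphic function, to which the maximum principle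
  -- on a compact space applies.
  let F : X → ℂ := fun q => limUnder (𝓝[≠] q) f
  have hF : ∀ p, ∀ᶠ q in 𝓝 p, F q = G p (chartAt ℂ p q) := fun p => by
    have h1 : ∀ᶠ q in 𝓝 p, ∀ᶠ q' in 𝓝[≠] q, f q' = G p (chartAt ℂ p q') := by
      have h2 := eventually_nhdsNE_eventually_nhds_iff.2 (hfG' p)
      rw [eventually_nhdsWithin_iff] at h2
      filter_upwards [h2] with q hq
      by_cases hqp : q = p
      · rw [hqp]
        exact hfG' p
      · exact (hq hqp).filter_mono nhdsWithin_le_nhds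
    have h3 : ∀ᶠ q in 𝓝 p, ContinuousAt (G p) (chartAt ℂ p q) :=
      ((chartAt ℂ p).continuousAt (mem_chart_source ℂ p)).eventually
        ((hG p).eventually_analyticAt.mono fun z hz => hz.continuousAt)
    filter_upwards [h1, h3, (chartAt ℂ p).open_source.mem_nhds (mem_chart_source ℂ p)]
      with q hq1 hq2 hq3
    refine Tendsto.limUnder_eq ?_
    refine Tendsto.congr' (hq1.mono fun _ h => h.symm) ?_
    exact (hq2.tendsto.comp ((chartAt ℂ p).continuousAt hq3)).mono_left nhdsWithin_le_nhds
  have hd : MDifferentiable 𝓘(ℂ, ℂ) 𝓘(ℂ, ℂ) F := fun p => by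
    have h1 : MDifferentiableAt 𝓘(ℂ, ℂ) 𝓘(ℂ, ℂ) (G p ∘ chartAt ℂ p) p :=
      (hG p).differentiableAt.mdifferentiableAt.comp p
        (mdifferentiableAt_atlas (chart_mem_atlas ℂ p) (mem_chart_source ℂ p))
    exact h1.congr_of_eventuallyEq (hF p)
  obtain ⟨c, hc⟩ := hd.exists_eq_const_of_compactSpace
  refine ⟨c, eventuallyEq_codiscrete_iff.2 fun p => ?_⟩
  filter_upwards [hfG' p, nhdsWithin_le_nhds (hF p)] with q h1 h2
  rw [h1, ← h2, hc]
  rfl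

/-- The tool behind every uniqueness argument below: two functions with the same divisor differ by a
non-zero scalar. -/
theorem HasDivisor.eq_const [T1Space X] [CompactSpace X]
    [PreconnectedSpace X] [IsManifold 𝓘(ℂ, ℂ) ω X] [Nonempty X] {f : X → ℂ} (hf : HasDivisor f 0) :
    ∃ c : ℂ, c ≠ 0 ∧ f =ᶠ[codiscrete X] fun _ => c := by
  obtain ⟨c, hc⟩ := hf.1.eq_const_of_orderAt_nonneg fun p => by rw [hf.2]; rfl
  refine ⟨c, ?_, hc⟩
  rintro rfl
  obtain ⟨p⟩ := ‹Nonempty X›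
  have := (eventuallyEq_codiscrete_iff.1 hc p).and (hf.eventually_ne_zero p)
  obtain ⟨q, h1, h2⟩ := this.exists
  exact h2 h1

end RiemannSurface

/-! ### Involutions and symmetries acting on functions and divisors -/

theorem tendsto_nhdsNE_of_injective {X : Type*} [TopologicalSpace X] {φ : X → X}
    (hc : Continuous φ) (hi : Function.Injective φ) (p : X) :
    Tendsto φ (𝓝[≠] p) (𝓝[≠] (φ p)) :=
  tendsto_nhdsWithin_of_tendsto_nhds_of_eventually_within _
    (hc.continuousAt.tendsto.mono_left nhdsWithin_le_nhds)
    (eventually_nhdsWithin_of_forall fun _ hq h => hq (hi h))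

theorem divisorMap_apply {X : Type*} {φ : X → X} (h : Function.Involutive φ) (D : Divisor X)
    (p : X) : divisorMap φ D p = D (φ p) := by
  conv_lhs => rw [← h p]
  exact Finsupp.mapDomain_apply h.injective D (φ p)

theorem divisorMap_single {X : Type*} (φ : X → X) (p : X) (n : ℤ) :
    divisorMap φ (Finsupp.single p n) = Finsupp.single (φ p) n :=
  Finsupp.mapDomain_single

theorem divisorMap_divisorMap {X : Type*} {φ : X → X} (h : Function.Involutive φ)
    (D : Divisor X) : divisorMap φ (divisorMap φ D) = D := by
  ext p
  rw [divisorMap_apply h, divisorMap_apply h, h]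

theorem analyticAt_conj_conj {g : ℂ → ℂ} {w : ℂ} (hg : AnalyticAt ℂ g (starRingEnd ℂ w)) :
    AnalyticAt ℂ (fun z => starRingEnd ℂ (g (starRingEnd ℂ z))) w := by
  rw [Complex.analyticAt_iff_eventually_differentiableAt] at hg ⊢
  have := (Complex.continuous_conj.tendsto w).eventually hg
  filter_upwards [this] with z hz
  have h2 := hz.conj_conj
  simpa [Function.comp_def] using h2

theorem tendsto_conj_nhdsNE (w : ℂ) :
    Tendsto (starRingEnd ℂ) (𝓝[≠] w) (𝓝[≠] (starRingEnd ℂ w)) :=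
  tendsto_nhdsNE_of_injective Complex.continuous_conj (starRingEnd ℂ).injective w

theorem meromorphicOrderAt_conj_conj {g : ℂ → ℂ} {w : ℂ} {n : ℤ}
    (hg : MeromorphicAt g (starRingEnd ℂ w)) (hn : meromorphicOrderAt g (starRingEnd ℂ w) = n) :
    MeromorphicAt (fun z => starRingEnd ℂ (g (starRingEnd ℂ z))) w ∧
      meromorphicOrderAt (fun z => starRingEnd ℂ (g (starRingEnd ℂ z))) w = n := by
  obtain ⟨G, hG, hG0, hGe⟩ := (meromorphicOrderAt_eq_int_iff hg).1 hn
  have he : ∀ᶠ z in 𝓝[≠] w, starRingEnd ℂ (g (starRingEnd ℂ z)) =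
      (z - w) ^ n • starRingEnd ℂ (G (starRingEnd ℂ z)) := by
    filter_upwards [(tendsto_conj_nhdsNE w).eventually hGe] with z hz
    rw [hz]
    simp
  have hm : MeromorphicAt (fun z => starRingEnd ℂ (g (starRingEnd ℂ z))) w :=
    MeromorphicAt.iff_eventuallyEq_zpow_smul_analyticAt.2
      ⟨n, _, analyticAt_conj_conj hG, he⟩
  exact ⟨hm, (meromorphicOrderAt_eq_int_iff hm).2 ⟨_, analyticAt_conj_conj hG, by simpa, he⟩⟩

section RiemannSurface

variable {X : Type*} [TopologicalSpace X] [ChartedSpace ℂ X]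

theorem tendsto_chartAt_symm (p : X) :
    Tendsto (chartAt ℂ p).symm (𝓝 (chartAt ℂ p p)) (𝓝 p) := by
  have := (chartAt ℂ p).continuousAt_symm (mem_chart_target ℂ p)
  rwa [ContinuousAt, (chartAt ℂ p).left_inv (mem_chart_source ℂ p)] at this

theorem chartAt_symm_chartAt_self (p : X) : (chartAt ℂ p).symm (chartAt ℂ p p) = p :=
  (chartAt ℂ p).left_inv (mem_chart_source ℂ p)

theorem eventually_comp_chartAt_symm {φ : X → X} (hφ : Continuous φ) (p : X) :
    ∀ᶠ z in 𝓝 (chartAt ℂ p p), (chartAt ℂ (φ p)).symm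
      (chartAt ℂ (φ p) (φ ((chartAt ℂ p).symm z))) = φ ((chartAt ℂ p).symm z) := by
  have h := (hφ.tendsto p).comp (tendsto_chartAt_symm p)
  filter_upwards [h.eventually ((chartAt ℂ (φ p)).open_source.mem_nhds (mem_chart_source ℂ (φ p)))]
    with z hz
  exact (chartAt ℂ (φ p)).left_inv hz

/-- Pulling back a meromorphic function by a map that is biholomorphic in charts. -/
theorem IsMeromorphicFun.comp {φ : X → X} (hφ : Continuous φ)
    (ha : ∀ p, AnalyticAt ℂ (chartAt ℂ (φ p) ∘ φ ∘ (chartAt ℂ p).symm) (chartAt ℂ p p))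
    (hd : ∀ p, deriv (chartAt ℂ (φ p) ∘ φ ∘ (chartAt ℂ p).symm) (chartAt ℂ p p) ≠ 0)
    {f : X → ℂ} (hf : IsMeromorphicFun f) :
    IsMeromorphicFun (f ∘ φ) ∧ ∀ p, orderAt (f ∘ φ) p = orderAt f (φ p) := by
  have key : ∀ p, (f ∘ φ) ∘ (chartAt ℂ p).symm =ᶠ[𝓝 (chartAt ℂ p p)]
      (f ∘ (chartAt ℂ (φ p)).symm) ∘ (chartAt ℂ (φ p) ∘ φ ∘ (chartAt ℂ p).symm) := fun p => by
    filter_upwards [eventually_comp_chartAt_symm hφ p] with z hz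
    simp only [Function.comp, hz]
  have hval : ∀ p, (chartAt ℂ (φ p) ∘ φ ∘ (chartAt ℂ p).symm) (chartAt ℂ p p) =
      chartAt ℂ (φ p) (φ p) := fun p => by
    simp only [Function.comp, chartAt_symm_chartAt_self]
  constructor
  · intro p
    refine MeromorphicAt.congr ?_ ((key p).symm.filter_mono nhdsWithin_le_nhds)
    refine MeromorphicAt.comp_analyticAt ?_ (ha p)
    rw [hval]
    exact hf (φ p)
  · intro p
    rw [orderAt, meromorphicOrderAt_congr ((key p).filter_mono nhdsWithin_le_nhds),
      meromorphicOrderAt_comp_of_deriv_ne_zero (ha p) (hd p), hval]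
    rfl

namespace IsSymmetry

variable {τ : X → X} (hτ : IsSymmetry τ)

include hτ

/-- The conjugated coordinate expressions of $\tau$ at $p$ and at $\tau p$ are inverse to each
other, up to conjugating one of them on both sides. The chain rule then excludes a zero derivative.
-/
theorem deriv_ne_zero (p : X) :
    deriv (fun z => (starRingEnd ℂ) (chartAt ℂ (τ p) (τ ((chartAt ℂ p).symm z))))
      (chartAt ℂ p p) ≠ 0 := by
  set ψ := fun z => (starRingEnd ℂ) (chartAt ℂ (τ p) (τ ((chartAt ℂ p).symm z))) with hψ
  set χ := fun z => (starRingEnd ℂ) (chartAt ℂ p (τ ((chartAt ℂ (τ p)).symm z))) with hχ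
  have hχa : AnalyticAt ℂ χ (chartAt ℂ (τ p) (τ p)) := by
    have := hτ.antiholomorphic (τ p)
    rwa [hτ.involutive p] at this
  have hψp : ψ (chartAt ℂ p p) = starRingEnd ℂ (chartAt ℂ (τ p) (τ p)) := by
    rw [hψ]
    simp only [chartAt_symm_chartAt_self]
  have hχ' : AnalyticAt ℂ (fun z => starRingEnd ℂ (χ (starRingEnd ℂ z)))
      (ψ (chartAt ℂ p p)) := analyticAt_conj_conj (by rwa [hψp, Complex.conj_conj])
  have hid : (fun z => starRingEnd ℂ (χ (starRingEnd ℂ z))) ∘ ψ =ᶠ[𝓝 (chartAt ℂ p p)] id := by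
    filter_upwards [eventually_comp_chartAt_symm hτ.continuous p,
      (chartAt ℂ p).open_target.mem_nhds (mem_chart_target ℂ p)] with z h1 h2
    simp only [hψ, hχ, Function.comp, Complex.conj_conj, h1, hτ.involutive _, id]
    exact (chartAt ℂ p).right_inv h2
  intro h0
  have h1 := hid.deriv_eq
  rw [deriv_comp _ hχ'.differentiableAt (hτ.antiholomorphic p).differentiableAt] at h1
  rw [h0, mul_zero, deriv_id] at h1
  exact zero_ne_one h1

/-- In charts the function is $(\overline{\,\cdot\,}\circ f\circ\overline{\,\cdot\,})\circ\psi$,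
with $\psi$ the conjugate of $\tau$. Conjugation on both sides preserves orders, and $\psi$ is
holomorphic with non-zero derivative. -/
theorem hasDivisor_conj_comp {f : X → ℂ} {D : Divisor X} (hf : HasDivisor f D) :
    HasDivisor (fun p => starRingEnd ℂ (f (τ p))) (divisorMap τ D) := by
  have key : ∀ p, MeromorphicAt ((fun p => starRingEnd ℂ (f (τ p))) ∘ (chartAt ℂ p).symm)
      (chartAt ℂ p p) ∧ orderAt (fun p => starRingEnd ℂ (f (τ p))) p = (D (τ p) : WithTop ℤ) := by
    intro p
    set ψ := fun z => (starRingEnd ℂ) (chartAt ℂ (τ p) (τ ((chartAt ℂ p).symm z))) with hψ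
    have hψp : starRingEnd ℂ (ψ (chartAt ℂ p p)) = chartAt ℂ (τ p) (τ p) := by
      rw [hψ]
      simp only [chartAt_symm_chartAt_self, Complex.conj_conj]
    have he : (fun p => starRingEnd ℂ (f (τ p))) ∘ (chartAt ℂ p).symm =ᶠ[𝓝 (chartAt ℂ p p)]
        (fun z => starRingEnd ℂ ((f ∘ (chartAt ℂ (τ p)).symm) (starRingEnd ℂ z))) ∘ ψ := by
      filter_upwards [eventually_comp_chartAt_symm hτ.continuous p] with z hz
      simp only [hψ, Function.comp, Complex.conj_conj, hz]
    have h := meromorphicOrderAt_conj_conj (g := f ∘ (chartAt ℂ (τ p)).symm)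
      (w := ψ (chartAt ℂ p p)) (n := D (τ p)) (by rw [hψp]; exact hf.1 (τ p))
      (by rw [hψp]; exact hf.2 (τ p))
    have hb := he.symm.filter_mono (nhdsWithin_le_nhds (s := {chartAt ℂ p p}ᶜ))
    refine ⟨(h.1.comp_analyticAt (hτ.antiholomorphic p)).congr hb, ?_⟩
    rw [orderAt, ← meromorphicOrderAt_congr hb,
      meromorphicOrderAt_comp_of_deriv_ne_zero (hτ.antiholomorphic p) (hτ.deriv_ne_zero p), h.2]
  exact ⟨fun p => (key p).1, fun p => by rw [(key p).2, divisorMap_apply hτ.involutive]⟩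

theorem divisorMap_mem_principalDivisors {D : Divisor X} (hD : D ∈ principalDivisors X) :
    divisorMap τ D ∈ principalDivisors X := by
  obtain ⟨f, hf⟩ := hD
  exact ⟨_, hτ.hasDivisor_conj_comp hf⟩

end IsSymmetry

/-! ### Uniqueness of the canonical class -/

/-- Cotangent lines are one-dimensional, so the chart contributes a factor `m` common to all forms,
which cancels in the quotient of two forms. -/
theorem exists_formCoeff_eq (p : X) : ∃ m : ℂ → ℂ,
    ∀ (η : ∀ q : X, TangentSpace 𝓘(ℂ, ℂ) q →L[ℂ] ℂ) (z : ℂ),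
      formCoeff η p z = m z * η ((chartAt ℂ p).symm z) (1 : ℂ) := by
  have key : ∀ (L : ℂ →L[ℂ] ℂ) (v : ℂ), L v = v * L 1 := fun L v => by
    rw [← smul_eq_mul, ← L.map_smul, smul_eq_mul, mul_one]
  exact ⟨fun z => mfderiv 𝓘(ℂ, ℂ) 𝓘(ℂ, ℂ) (chartAt ℂ p).symm z (1 : ℂ), fun η z => key _ _⟩

/-- Any two canonical divisors are linearly equivalent. -/
theorem IsCanonical.linEquiv {K K' : Divisor X} (hK : IsCanonical K) (hK' : IsCanonical K') :
    LinEquiv K K' := by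
  obtain ⟨η, hη⟩ := hK
  obtain ⟨η', hη'⟩ := hK'
  have he : ∀ p : X, (formCoeff η p / formCoeff η' p) =ᶠ[𝓝[≠] (chartAt ℂ p p)]
      (fun q : X => (η q (1 : ℂ) / η' q (1 : ℂ) : ℂ)) ∘ (chartAt ℂ p).symm := fun p => by
    have h0 := (meromorphicOrderAt_ne_top_iff_eventually_ne_zero (hη' p).1).1
      (by rw [(hη' p).2]; exact WithTop.coe_ne_top)
    filter_upwards [h0] with z hz
    obtain ⟨m, hm⟩ := exists_formCoeff_eq p
    rw [hm] at hz
    rw [Pi.div_apply, hm, hm, mul_div_mul_left _ _ (left_ne_zero_of_mul hz)]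
    rfl
  refine ⟨fun q => η q (1 : ℂ) / η' q (1 : ℂ), fun p => ((hη p).1.div (hη' p).1).congr (he p),
    fun p => ?_⟩
  rw [orderAt, ← meromorphicOrderAt_congr (he p), meromorphicOrderAt_div (hη p).1 (hη' p).1,
    (hη p).2, (hη' p).2, Finsupp.sub_apply]
  rfl

end RiemannSurface

/-! ### Topology of the hyperelliptic surface: compactness, connectedness, the hyperelliptic
involution -/

theorem AffineHyperelliptic.isClosed (P : ℂ[X]) :
    IsClosed {p : ℂ × ℂ | p.2 ^ 2 = P.eval p.1} :=
  isClosed_eq (by fun_prop) (P.continuous.comp continuous_fst)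

theorem AffineHyperelliptic.isCompact_norm_le (P : ℂ[X]) :
    IsCompact {p : AffineHyperelliptic P | ‖p.1.1‖ ≤ 1} := by
  obtain ⟨M, hM⟩ := (isCompact_closedBall (0 : ℂ) 1).exists_bound_of_continuousOn
    P.continuous.continuousOn
  have hK : IsCompact (Metric.closedBall (0 : ℂ) 1 ×ˢ Metric.closedBall (0 : ℂ) (max 1 M)) :=
    (isCompact_closedBall _ _).prod (isCompact_closedBall _ _)
  have hemb : IsClosedEmbedding (Subtype.val : AffineHyperelliptic P → ℂ × ℂ) :=
    (AffineHyperelliptic.isClosed P).isClosedEmbedding_subtypeVal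
  refine (hemb.isCompact_preimage hK).of_isClosed_subset
    (isClosed_le (by fun_prop) continuous_const) fun p hp => ?_
  have hx : p.1.1 ∈ Metric.closedBall (0 : ℂ) 1 := by simpa using hp
  refine ⟨hx, ?_⟩
  have h := hM _ hx
  rw [← p.2, norm_pow] at h
  rw [mem_closedBall_zero_iff]
  by_contra hlt
  rw [not_le, max_lt_iff] at hlt
  nlinarith [hlt.1, hlt.2]

/-- The involution `(x, y) ↦ (x, -y)` of an affine hyperelliptic curve. -/
def AffineHyperelliptic.flip {P : ℂ[X]} (p : AffineHyperelliptic P) : AffineHyperelliptic P :=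
  ⟨(p.1.1, -p.1.2), by simpa using p.2⟩

theorem AffineHyperelliptic.continuous_flip (P : ℂ[X]) :
    Continuous (AffineHyperelliptic.flip (P := P)) := by
  unfold AffineHyperelliptic.flip
  fun_prop

/-- The coordinate change `t ↦ 1 / t` as a map to the Riemann sphere. -/
noncomputable def invToSphere (t : ℂ) : OnePoint ℂ :=
  open Classical in if t = 0 then OnePoint.infty else ((t⁻¹ : ℂ) : OnePoint ℂ)

theorem continuous_invToSphere : Continuous invToSphere := by
  rw [continuous_iff_continuousAt]
  intro t
  by_cases ht : t = 0
  · subst ht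
    rw [continuousAt_iff_punctured_nhds]
    have h0 : invToSphere 0 = OnePoint.infty := if_pos rfl
    rw [h0]
    have h : Tendsto (fun t : ℂ => ((t⁻¹ : ℂ) : OnePoint ℂ)) (𝓝[≠] 0) (𝓝 OnePoint.infty) := by
      refine OnePoint.tendsto_coe_infty.comp ?_
      rw [coclosedCompact_eq_cocompact, ← Metric.cobounded_eq_cocompact]
      exact tendsto_inv₀_nhdsNE_zero
    refine h.congr' (eventually_nhdsWithin_of_forall fun s hs => (if_neg hs).symm)
  · have h : ContinuousAt (fun t : ℂ => ((t⁻¹ : ℂ) : OnePoint ℂ)) t :=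
      OnePoint.continuous_coe.continuousAt.comp (continuousAt_inv₀ ht)
    refine h.congr ?_
    filter_upwards [isOpen_ne.mem_nhds ht] with s hs
    exact (if_neg hs).symm

namespace HyperellipticEquation

variable {g : ℕ} (C : HyperellipticEquation g)

theorem continuous_iff {Y : Type*} [TopologicalSpace Y] {f : C.Surface → Y} :
    Continuous f ↔ Continuous (f ∘ Surface.affine) ∧ Continuous (f ∘ C.ofInfinityPart) := by
  simp only [continuous_def, C.isOpen_iff, Set.preimage_comp, forall_and]

theorem affine_injective : Function.Injective (Surface.affine : C.AffinePart → C.Surface) :=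
  fun p q h => by simpa using h

instance : T1Space C.Surface where
  t1 p := by
    rw [← isOpen_compl_iff, C.isOpen_iff]
    constructor
    · rw [Set.preimage_compl, isOpen_compl_iff]
      exact (Set.subsingleton_singleton.preimage C.affine_injective).isClosed
    · rw [Set.preimage_compl, isOpen_compl_iff]
      exact (Set.subsingleton_singleton.preimage C.ofInfinityPart_injective).isClosed

/-- The hyperelliptic involution. -/
def flip : C.Surface → C.Surface
  | .affine p => .affine p.flip
  | .infinity w => .infinity ⟨-w.1, by simpa using w.2⟩

theorem flip_involutive : Function.Involutive C.flip := by
  rintro (p | w) <;> simp [flip, AffineHyperelliptic.flip]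

theorem flip_ofInfinityPart (q : C.InfinityPart) :
    C.flip (C.ofInfinityPart q) = C.ofInfinityPart q.flip := by
  obtain ⟨⟨t, w⟩, h⟩ := q
  by_cases ht : t = 0
  · simp [ofInfinityPart, AffineHyperelliptic.flip, flip, ht]
  · simp [ofInfinityPart, AffineHyperelliptic.flip, flip, ht, neg_div]

theorem continuous_affine : Continuous (Surface.affine : C.AffinePart → C.Surface) :=
  C.isOpenEmbedding_affine.continuous

theorem continuous_ofInfinityPart : Continuous C.ofInfinityPart :=
  C.isOpenEmbedding_ofInfinityPart.continuous

theorem continuous_flip : Continuous C.flip := by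
  rw [C.continuous_iff]
  constructor
  · exact C.continuous_affine.comp (AffineHyperelliptic.continuous_flip _)
  · have : C.flip ∘ C.ofInfinityPart = C.ofInfinityPart ∘ AffineHyperelliptic.flip :=
      funext C.flip_ofInfinityPart
    rw [this]
    exact C.continuous_ofInfinityPart.comp (AffineHyperelliptic.continuous_flip _)

theorem xy_flip (p : C.Surface) : C.xy (C.flip p) = ((C.xy p).1, -(C.xy p).2) := by
  cases p with
  | affine p => rfl
  | infinity w => simp [flip, xy, Prod.ext_iff]

theorem tw_flip (p : C.Surface) : C.tw (C.flip p) = ((C.tw p).1, -(C.tw p).2) := by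
  cases p with
  | affine p => simp [flip, tw, AffineHyperelliptic.flip, neg_div]
  | infinity w => simp [flip, tw]

theorem proj_ofInfinityPart (q : C.InfinityPart) :
    C.proj (C.ofInfinityPart q) = invToSphere q.1.1 := by
  by_cases h : q.1.1 = 0 <;> simp [ofInfinityPart, h, proj, invToSphere]

theorem continuous_proj : Continuous C.proj := by
  rw [C.continuous_iff]
  constructor
  · exact OnePoint.continuous_coe.comp (continuous_fst.comp continuous_subtype_val)
  · have : C.proj ∘ C.ofInfinityPart = fun q => invToSphere q.1.1 := funext C.proj_ofInfinityPart
    rw [this]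
    exact continuous_invToSphere.comp (continuous_fst.comp continuous_subtype_val)

theorem proj_surjective : Function.Surjective C.proj := by
  intro x
  induction x using OnePoint.rec with
  | infty =>
    obtain ⟨w, hw⟩ := IsAlgClosed.exists_pow_nat_eq (C.revPoly.eval 0) (n := 2) (by norm_num)
    exact ⟨.infinity ⟨w, hw⟩, rfl⟩
  | coe x =>
    obtain ⟨y, hy⟩ := IsAlgClosed.exists_pow_nat_eq (C.poly.eval x) (n := 2) (by norm_num)
    exact ⟨.affine ⟨(x, y), hy⟩, rfl⟩

theorem proj_flip (p : C.Surface) : C.proj (C.flip p) = C.proj p := by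
  cases p <;> rfl

theorem proj_eq_iff {p q : C.Surface} : C.proj p = C.proj q ↔ p = q ∨ p = C.flip q := by
  constructor
  · intro h
    rcases p with ⟨⟨⟨x, y⟩, hp⟩⟩ | ⟨w, hw⟩ <;> rcases q with ⟨⟨⟨x', y'⟩, hq⟩⟩ | ⟨w', hw'⟩
    · simp only [proj, OnePoint.coe_eq_coe] at h
      subst h
      have h2 : y ^ 2 = y' ^ 2 := hp.trans hq.symm
      rcases sq_eq_sq_iff_eq_or_eq_neg.1 h2 with rfl | rfl
      · exact Or.inl rfl
      · exact Or.inr rfl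
    · exact absurd h (OnePoint.coe_ne_infty _)
    · exact absurd h (OnePoint.infty_ne_coe _)
    · rcases sq_eq_sq_iff_eq_or_eq_neg.1 (hw.trans hw'.symm) with rfl | rfl
      · exact Or.inl rfl
      · exact Or.inr rfl
  · rintro (rfl | rfl)
    · rfl
    · exact C.proj_flip q

/-- The surface is the union of the parts $|x|\le1$ and $|t|\le1$, each the image of a bounded
closed piece of an affine curve. -/
instance : CompactSpace C.Surface := by
  refine ⟨?_⟩
  have h1 := (AffineHyperelliptic.isCompact_norm_le C.poly).image C.continuous_affine
  have h2 := (AffineHyperelliptic.isCompact_norm_le C.revPoly).image C.continuous_ofInfinityPart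
  convert h1.union h2
  symm
  rw [Set.eq_univ_iff_forall]
  rintro (p | w)
  · by_cases hp : ‖p.1.1‖ ≤ 1
    · exact Or.inl ⟨p, hp, rfl⟩
    · have h0 : p.1.1 ≠ 0 := by
        intro h0
        rw [h0, norm_zero] at hp
        exact hp zero_le_one
      refine Or.inr ⟨⟨(p.1.1⁻¹, p.1.2 / p.1.1 ^ (g + 1)), ?_⟩, ?_, ?_⟩
      · rw [C.revPoly_eval (inv_ne_zero h0), inv_inv, ← p.2]
        simp only [inv_pow, div_pow]
        field_simp
        ring
      · simp only [Set.mem_ofPred_eq, norm_inv]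
        exact inv_le_one_of_one_le₀ (not_le.1 hp).le
      · have : p.1.2 / p.1.1 ^ (g + 1) / p.1.1⁻¹ ^ (g + 1) = p.1.2 := by
          rw [inv_pow]
          field_simp
        simp only [ofInfinityPart, inv_eq_zero, h0, dite_false, inv_inv, this]
  · exact Or.inr ⟨⟨(0, w.1), w.2⟩, by simp, C.ofInfinityPart_zero w⟩

theorem natDegree_poly_pos : 0 < C.poly.natDegree := by
  rcases C.natDegree_eq with h | h <;> omega

theorem exists_flip_eq : ∃ p : C.Surface, C.flip p = p := by
  obtain ⟨a, ha⟩ := IsAlgClosed.exists_root C.poly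
    (by rw [degree_eq_natDegree C.monic.ne_zero]; exact_mod_cast C.natDegree_poly_pos.ne')
  refine ⟨.affine ⟨(a, 0), ?_⟩, ?_⟩
  · rw [ha.eq_zero]
    simp
  · simp [flip, AffineHyperelliptic.flip]

instance : Nonempty C.Surface := ⟨C.exists_flip_eq.choose⟩

/-- An invariant set is a union of fibres of $\pi$, so its image and the image of its complement
partition the sphere. Both images are compact, and the sphere is connected. -/
theorem eq_empty_or_univ_of_flip_invariant {A : Set C.Surface} (hA : IsClopen A)
    (hf : ∀ p, C.flip p ∈ A ↔ p ∈ A) : A = ∅ ∨ A = Set.univ := by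
  have hinv : ∀ p q, C.proj p = C.proj q → (p ∈ A ↔ q ∈ A) := by
    intro p q h
    rcases C.proj_eq_iff.1 h with rfl | rfl
    · rfl
    · exact hf q
  have hc : (C.proj '' A)ᶜ = C.proj '' Aᶜ := by
    ext x
    obtain ⟨p, rfl⟩ := C.proj_surjective x
    constructor
    · intro h
      exact ⟨p, fun hp => h ⟨p, hp, rfl⟩, rfl⟩
    · rintro ⟨q, hq, h⟩ ⟨q', hq', h'⟩
      exact hq ((hinv _ _ (h.trans h'.symm)).2 hq')
  have hcl : IsClopen (C.proj '' A) := by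
    refine ⟨(hA.1.isCompact.image C.continuous_proj).isClosed, ?_⟩
    rw [← isClosed_compl_iff, hc]
    exact (hA.compl.1.isCompact.image C.continuous_proj).isClosed
  rcases isClopen_iff.1 hcl with h | h
  · exact Or.inl (Set.image_eq_empty.1 h)
  · right
    rw [h, Set.compl_univ] at hc
    exact Set.compl_empty_iff.1 (Set.image_eq_empty.1 hc.symm)

/-- The union and the intersection of a clopen set with its flip are invariant, hence trivial. A
Weierstrass point lies in both or in neither, which rules out two sheets exchanged by the flip. -/
instance : PreconnectedSpace C.Surface := by
  rw [preconnectedSpace_iff_clopen]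
  intro A hA
  have hJ : IsClopen (C.flip ⁻¹' A) := hA.preimage C.continuous_flip
  rcases C.eq_empty_or_univ_of_flip_invariant (hA.union hJ) (fun p => by
    simp only [Set.mem_union, Set.mem_preimage, C.flip_involutive p, or_comm]) with h | h
  · exact Or.inl (Set.union_empty_iff.1 h).1
  · rcases C.eq_empty_or_univ_of_flip_invariant (hA.inter hJ) (fun p => by
      simp only [Set.mem_inter_iff, Set.mem_preimage, C.flip_involutive p, and_comm]) with h' | h'
    · obtain ⟨p, hp⟩ := C.exists_flip_eq
      have h1 : p ∈ A ∪ C.flip ⁻¹' A := h ▸ Set.mem_univ p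
      have h2 : p ∈ A ∩ C.flip ⁻¹' A := by
        simpa only [Set.mem_union, Set.mem_inter_iff, Set.mem_preimage, hp, or_self,
          and_self] using h1
      rw [h'] at h2
      exact absurd h2 (Set.notMem_empty p)
    · exact Or.inr (Set.univ_subset_iff.1 (h' ▸ Set.inter_subset_left))

end HyperellipticEquation

/-! ### Orders of the coordinate functions and the involution in charts -/

theorem meromorphicOrderAt_eq_zero_of_ne {f : ℂ → ℂ} {z : ℂ} (hf : AnalyticAt ℂ f z)
    (h : f z ≠ 0) : meromorphicOrderAt f z = 0 :=
  (tendsto_ne_zero_iff_meromorphicOrderAt_eq_zero hf.meromorphicAt).1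
    ⟨f z, h, hf.continuousAt.tendsto.mono_left nhdsWithin_le_nhds⟩

theorem meromorphicOrderAt_sub_const_of_eventuallyEq_id {A : ℂ → ℂ} {z : ℂ}
    (h : ∀ᶠ w in 𝓝 z, A w = w) : meromorphicOrderAt (fun w => A w - z) z = 1 := by
  rw [← meromorphicOrderAt_id_sub_const (𝕜 := ℂ) (x := z)]
  refine meromorphicOrderAt_congr (EventuallyEq.filter_mono ?_ nhdsWithin_le_nhds)
  filter_upwards [h] with w hw
  rw [hw]

/-- Near a point where one of the coordinates is a local parameter, the coordinates `A`, `B` of a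
curve `B² = R(A)` have the orders prescribed by the ramification of `A`. -/
theorem meromorphicOrderAt_coordinates {R : ℂ[X]} {A B : ℂ → ℂ} {z : ℂ} (hA : AnalyticAt ℂ A z)
    (hB : AnalyticAt ℂ B z) (hAB : ∀ w, B w ^ 2 = R.eval (A w))
    (h1 : B z ≠ 0 → ∀ᶠ w in 𝓝 z, A w = w) (h2 : B z = 0 → ∀ᶠ w in 𝓝 z, B w = w)
    (h3 : B z = 0 → R.derivative.eval (A z) ≠ 0) :
    meromorphicOrderAt (fun w => A w - A z) z = (if B z = 0 then 2 else 1 : ℤ) ∧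
      meromorphicOrderAt B z = (if B z = 0 then 1 else 0 : ℤ) := by
  by_cases hb : B z = 0
  · have hz : z = 0 := ((h2 hb).self_of_nhds).symm.trans hb
    have hBo : meromorphicOrderAt B z = 1 := by
      have := meromorphicOrderAt_sub_const_of_eventuallyEq_id (h2 hb)
      rw [hz] at this ⊢
      simpa using this
    have hroot : R.IsRoot (A z) := by
      rw [IsRoot, ← hAB, hb]
      simp
    -- Split off the simple root: $B^2=(A-A(z))\,Q(A)$, where $Q(A(z))=R'(A(z))\ne0$. Thus $A-A(z)$
    -- has twice the order of $B$.
    set Q := R /ₘ (X - C (A z)) with hQ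
    have hR : (X - C (A z)) * Q = R := mul_divByMonic_eq_iff_isRoot.2 hroot
    have hQ0 : Q.eval (A z) ≠ 0 := by
      have := h3 hb
      rw [← hR] at this
      simpa using this
    have hQa : AnalyticAt ℂ (fun w => Q.eval (A w)) z := hA.aeval_polynomial Q
    have hprod : (fun w => A w - A z) * (fun w => Q.eval (A w)) = B ^ 2 := by
      funext w
      simp only [Pi.mul_apply, Pi.pow_apply, hAB]
      conv_rhs => rw [← hR]
      simp
    have hsub : MeromorphicAt (fun w => A w - A z) z := (hA.sub analyticAt_const).meromorphicAt
    have h := meromorphicOrderAt_mul hsub hQa.meromorphicAt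
    rw [hprod, meromorphicOrderAt_eq_zero_of_ne hQa hQ0, add_zero,
      meromorphicOrderAt_pow hB.meromorphicAt, hBo] at h
    rw [← h, hBo, if_pos hb, if_pos hb]
    exact ⟨rfl, rfl⟩
  · have hz : A z = z := (h1 hb).self_of_nhds
    rw [hz, meromorphicOrderAt_sub_const_of_eventuallyEq_id (h1 hb),
      meromorphicOrderAt_eq_zero_of_ne hB hb, if_neg hb, if_neg hb]
    exact ⟨rfl, rfl⟩

theorem affineChart_of_ne {P : ℂ[X]} {p : AffineHyperelliptic P}
    (h : p.1.2 = 0 → P.derivative.eval p.1.1 ≠ 0) (hb : p.1.2 ≠ 0) (q : AffineHyperelliptic P) :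
    affineChart P p h q = q.1.1 := by
  unfold affineChart
  rw [dif_neg hb]
  rfl

theorem affineChart_of_eq {P : ℂ[X]} {p : AffineHyperelliptic P}
    (h : p.1.2 = 0 → P.derivative.eval p.1.1 ≠ 0) (hb : p.1.2 = 0) (q : AffineHyperelliptic P) :
    affineChart P p h q = q.1.2 := by
  unfold affineChart
  rw [dif_pos hb]
  rfl

namespace HyperellipticEquation

variable {g : ℕ} (C : HyperellipticEquation g)

theorem chart_affine_affine (p q : C.AffinePart) : C.chart (.affine p) (.affine q) =
    affineChart C.poly p (C.smooth_affine p) q :=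
  haveI : Nonempty C.AffinePart := ⟨p⟩
  congrArg _ (IsOpenEmbedding.toOpenPartialHomeomorph_left_inv _ C.isOpenEmbedding_affine)

theorem chart_infinity_ofInfinityPart (w : {w : ℂ // w ^ 2 = C.revPoly.eval 0})
    (q : C.InfinityPart) : C.chart (.infinity w) (C.ofInfinityPart q) =
    affineChart C.revPoly ⟨(0, w.1), w.2⟩ (C.smooth_infinity w) q :=
  haveI : Nonempty C.InfinityPart := ⟨⟨(0, w.1), w.2⟩⟩
  congrArg _ (IsOpenEmbedding.toOpenPartialHomeomorph_left_inv _ C.isOpenEmbedding_ofInfinityPart)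

theorem chart_affine_symm (p : C.AffinePart) (z : ℂ) :
    ∃ q : C.AffinePart, (C.chart (.affine p)).symm z = .affine q := ⟨_, rfl⟩

theorem chart_infinity_symm (w : {w : ℂ // w ^ 2 = C.revPoly.eval 0}) (z : ℂ) :
    ∃ q : C.InfinityPart, (C.chart (.infinity w)).symm z = C.ofInfinityPart q := ⟨_, rfl⟩

theorem affine_flip_eq_iff (p : C.AffinePart) :
    C.flip (.affine p) = .affine p ↔ p.1.2 = 0 := by
  simp only [flip, AffineHyperelliptic.flip, Surface.affine.injEq, Subtype.ext_iff, Prod.ext_iff,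
    true_and]
  exact neg_eq_self

theorem infinity_flip_eq_iff (w : {w : ℂ // w ^ 2 = C.revPoly.eval 0}) :
    C.flip (.infinity w) = .infinity w ↔ w.1 = 0 := by
  simp only [flip, Surface.infinity.injEq, Subtype.ext_iff]
  exact neg_eq_self

theorem xy_ofInfinityPart' (q : C.InfinityPart) :
    C.xy (C.ofInfinityPart q) = (q.1.1⁻¹, q.1.2 / q.1.1 ^ (g + 1)) := by
  by_cases h : q.1.1 = 0
  · simp [ofInfinityPart, h, xy, Prod.ext_iff]
  · exact C.xy_ofInfinityPart q h

theorem eventually_mem_target (p : C.Surface) :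
    ∀ᶠ z in 𝓝 (C.chart p p), z ∈ (C.chart p).target :=
  (C.chart p).open_target.mem_nhds ((C.chart p).map_source (C.mem_chart_source p))

theorem chart_symm_self (p : C.Surface) : (C.chart p).symm (C.chart p p) = p :=
  (C.chart p).left_inv (C.mem_chart_source p)

theorem analyticAt_xy (p : C.AffinePart) :
    AnalyticAt ℂ (fun z => C.xy ((C.chart (.affine p)).symm z)) (C.chart (.affine p) (.affine p)) := by
  refine DifferentiableOn.analyticAt (s := (C.chart (.affine p)).target) ?_
    (C.eventually_mem_target _)
  refine (C.xy_chart_symm (.affine p)).mono fun z hz => ⟨hz, ?_⟩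
  obtain ⟨q, hq⟩ := C.chart_affine_symm p z
  exact ⟨q, hq.symm⟩

theorem analyticAt_tw (w : {w : ℂ // w ^ 2 = C.revPoly.eval 0}) :
    AnalyticAt ℂ (fun z => C.tw ((C.chart (.infinity w)).symm z))
      (C.chart (.infinity w) (.infinity w)) := by
  refine DifferentiableOn.analyticAt (s := (C.chart (.infinity w)).target) ?_
    (C.eventually_mem_target _)
  refine (C.tw_chart_symm (.infinity w)).mono fun z hz => ⟨hz, ?_⟩
  obtain ⟨q, hq⟩ := C.chart_infinity_symm w z
  exact ⟨q, hq.symm⟩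

open Classical in
theorem chart_affine_apply {p : C.AffinePart} {q : C.Surface}
    (hq : q ∈ Set.range (Surface.affine (C := C))) :
    C.chart (.affine p) q = if C.flip (.affine p) = .affine p then (C.xy q).2 else (C.xy q).1 := by
  obtain ⟨q, rfl⟩ := hq
  rw [C.chart_affine_affine]
  split_ifs with h <;> rw [C.affine_flip_eq_iff] at h
  · rw [affineChart_of_eq _ h]
    rfl
  · rw [affineChart_of_ne _ h]
    rfl

open Classical in
theorem chart_infinity_apply {w : {w : ℂ // w ^ 2 = C.revPoly.eval 0}} {q : C.Surface}
    (hq : q ∈ Set.range C.ofInfinityPart) :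
    C.chart (.infinity w) q =
      if C.flip (.infinity w) = .infinity w then (C.tw q).2 else (C.tw q).1 := by
  obtain ⟨q, rfl⟩ := hq
  rw [C.chart_infinity_ofInfinityPart, C.tw_ofInfinityPart]
  split_ifs with h <;> rw [C.infinity_flip_eq_iff] at h
  · rw [affineChart_of_eq _ h]
  · rw [affineChart_of_ne _ h]

theorem flip_mem_range_affine {q : C.Surface} (hq : q ∈ Set.range (Surface.affine (C := C))) :
    C.flip q ∈ Set.range (Surface.affine (C := C)) := by
  obtain ⟨q, rfl⟩ := hq
  exact ⟨q.flip, rfl⟩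

theorem flip_mem_range_ofInfinityPart {q : C.Surface} (hq : q ∈ Set.range C.ofInfinityPart) :
    C.flip q ∈ Set.range C.ofInfinityPart := by
  obtain ⟨q, rfl⟩ := hq
  exact ⟨q.flip, (C.flip_ofInfinityPart q).symm⟩

open Classical in
/-- In the charts the hyperelliptic involution is `z ↦ z`, or `z ↦ -z` at a fixed point. -/
theorem chart_flip (p : C.Surface) {z : ℂ} (hz : z ∈ (C.chart p).target) :
    C.chart (C.flip p) (C.flip ((C.chart p).symm z)) = if C.flip p = p then -z else z := by
  have hr := (C.chart p).right_inv hz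
  have hfix : C.flip (C.flip p) = C.flip p ↔ C.flip p = p := by
    rw [C.flip_involutive]
    exact eq_comm
  cases p with
  | affine p =>
    have hm : (C.chart (.affine p)).symm z ∈ Set.range (Surface.affine (C := C)) :=
      ⟨_, (C.chart_affine_symm p z).choose_spec.symm⟩
    rw [C.chart_affine_apply hm] at hr
    have hf : C.flip (.affine p) = .affine p.flip := rfl
    rw [hf] at hfix ⊢
    rw [C.chart_affine_apply (C.flip_mem_range_affine hm), xy_flip]
    simp only [hfix]
    rw [hf] at hr
    split_ifs with h
    · rw [if_pos h] at hr
      rw [hr]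
    · rw [if_neg h] at hr
      rw [hr]
  | infinity w =>
    have hm : (C.chart (.infinity w)).symm z ∈ Set.range C.ofInfinityPart :=
      ⟨_, (C.chart_infinity_symm w z).choose_spec.symm⟩
    rw [C.chart_infinity_apply hm] at hr
    have hf : C.flip (.infinity w) = .infinity ⟨-w.1, by simpa using w.2⟩ := rfl
    rw [hf] at hfix ⊢
    rw [C.chart_infinity_apply (C.flip_mem_range_ofInfinityPart hm), tw_flip]
    simp only [hfix]
    rw [hf] at hr
    split_ifs with h
    · rw [if_pos h] at hr
      rw [hr]
    · rw [if_neg h] at hr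
      rw [hr]

/-- The ramification index of `π`. -/
noncomputable def ramification (p : C.Surface) : ℤ :=
  open Classical in if C.flip p = p then 2 else 1

theorem orders_affine (p : C.AffinePart) :
    orderAt (fun q => (C.xy q).1 - p.1.1) (.affine p) = C.ramification (.affine p) ∧
      orderAt (fun q => (C.xy q).2) (.affine p) = (C.ramification (.affine p) - 1 : ℤ) := by
  classical
  have ha := C.analyticAt_xy p
  have hz0 : C.xy ((C.chart (.affine p)).symm (C.chart (.affine p) (.affine p))) = p.1 := by
    rw [C.chart_symm_self]
    rfl
  have hm : ∀ z, (C.chart (.affine p)).symm z ∈ Set.range (Surface.affine (C := C)) := fun z =>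
    ⟨_, (C.chart_affine_symm p z).choose_spec.symm⟩
  have hiff : C.flip (.affine p) = .affine p ↔
      (C.xy ((C.chart (.affine p)).symm (C.chart (.affine p) (.affine p)))).2 = 0 := by
    rw [hz0, C.affine_flip_eq_iff]
  have key := meromorphicOrderAt_coordinates (R := C.poly)
    (A := fun z => (C.xy ((C.chart (.affine p)).symm z)).1)
    (B := fun z => (C.xy ((C.chart (.affine p)).symm z)).2)
    (z := C.chart (.affine p) (.affine p)) (analyticAt_fst.comp ha) (analyticAt_snd.comp ha)
    (fun w => by
      obtain ⟨q, hq⟩ := hm w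
      rw [← hq]
      exact q.2)
    (fun h => by
      filter_upwards [C.eventually_mem_target (.affine p)] with z hz
      have := C.chart_affine_apply (p := p) (hm z)
      rw [if_neg (by rwa [hiff]), (C.chart (.affine p)).right_inv hz] at this
      exact this.symm)
    (fun h => by
      filter_upwards [C.eventually_mem_target (.affine p)] with z hz
      have := C.chart_affine_apply (p := p) (hm z)
      rw [if_pos (by rwa [hiff]), (C.chart (.affine p)).right_inv hz] at this
      exact this.symm)
    (fun h => by
      rw [hz0] at h ⊢
      exact C.smooth_affine p h)
  simp only [← hiff] at key
  rw [hz0] at key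
  refine ⟨key.1.trans ?_, key.2.trans ?_⟩ <;> unfold ramification <;> split_ifs <;> rfl

theorem orders_infinity (w : {w : ℂ // w ^ 2 = C.revPoly.eval 0}) :
    orderAt (fun q => (C.tw q).1) (.infinity w) = C.ramification (.infinity w) ∧
      orderAt (fun q => (C.tw q).2) (.infinity w) = (C.ramification (.infinity w) - 1 : ℤ) := by
  classical
  have ha := C.analyticAt_tw w
  have hz0 : C.tw ((C.chart (.infinity w)).symm (C.chart (.infinity w) (.infinity w))) =
      (0, w.1) := by
    rw [C.chart_symm_self]
    rfl
  have hm : ∀ z, (C.chart (.infinity w)).symm z ∈ Set.range C.ofInfinityPart := fun z =>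
    ⟨_, (C.chart_infinity_symm w z).choose_spec.symm⟩
  have hiff : C.flip (.infinity w) = .infinity w ↔
      (C.tw ((C.chart (.infinity w)).symm (C.chart (.infinity w) (.infinity w)))).2 = 0 := by
    rw [hz0, C.infinity_flip_eq_iff]
  have key := meromorphicOrderAt_coordinates (R := C.revPoly)
    (A := fun z => (C.tw ((C.chart (.infinity w)).symm z)).1)
    (B := fun z => (C.tw ((C.chart (.infinity w)).symm z)).2)
    (z := C.chart (.infinity w) (.infinity w)) (analyticAt_fst.comp ha) (analyticAt_snd.comp ha)
    (fun w' => by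
      obtain ⟨q, hq⟩ := hm w'
      rw [← hq, C.tw_ofInfinityPart]
      exact q.2)
    (fun h => by
      filter_upwards [C.eventually_mem_target (.infinity w)] with z hz
      have := C.chart_infinity_apply (w := w) (hm z)
      rw [if_neg (by rwa [hiff]), (C.chart (.infinity w)).right_inv hz] at this
      exact this.symm)
    (fun h => by
      filter_upwards [C.eventually_mem_target (.infinity w)] with z hz
      have := C.chart_infinity_apply (w := w) (hm z)
      rw [if_pos (by rwa [hiff]), (C.chart (.infinity w)).right_inv hz] at this
      exact this.symm)
    (fun h => by
      rw [hz0] at h ⊢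
      exact C.smooth_infinity w h)
  simp only [← hiff] at key
  rw [hz0] at key
  simp only [sub_zero] at key
  refine ⟨key.1.trans ?_, key.2.trans ?_⟩ <;> unfold ramification <;> split_ifs <;> rfl

end HyperellipticEquation

/-! ### Divisors of $x-a$, $y$ and $dx/y$; Weierstrass points -/

namespace HyperellipticEquation

variable {g : ℕ} (C : HyperellipticEquation g)

/-- The fibre of `π` through `p`, as a divisor. -/
noncomputable def fiber (p : C.Surface) : Divisor C.Surface :=
  Finsupp.single p 1 + Finsupp.single (C.flip p) 1

theorem fiber_apply_of_eq {p q : C.Surface} (h : C.proj q = C.proj p) :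
    C.fiber p q = C.ramification q := by
  classical
  rw [fiber, Finsupp.add_apply, ramification, Finsupp.single_apply, Finsupp.single_apply]
  rcases C.proj_eq_iff.1 h with rfl | rfl
  · split_ifs <;> simp_all
  · by_cases hp : C.flip p = p
    · simp [hp]
    · have hp' : p ≠ C.flip p := fun h => hp h.symm
      simp [C.flip_involutive p, hp']

theorem fiber_apply_of_ne {p q : C.Surface} (h : C.proj q ≠ C.proj p) : C.fiber p q = 0 := by
  classical
  have := fun h' => h (C.proj_eq_iff.2 h')
  rw [fiber, Finsupp.add_apply, Finsupp.single_apply, Finsupp.single_apply, if_neg, if_neg, add_zero]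
  · rintro rfl
    exact this (Or.inr rfl)
  · rintro rfl
    exact this (Or.inl rfl)

theorem degree_fiber (p : C.Surface) : (C.fiber p).degree = 2 := by
  rw [fiber, map_add, Finsupp.degree_single, Finsupp.degree_single]
  norm_num

/-- A point over `∞`. -/
noncomputable def infPoint : C.Surface := (C.proj_surjective OnePoint.infty).choose

theorem proj_infPoint : C.proj C.infPoint = OnePoint.infty :=
  (C.proj_surjective OnePoint.infty).choose_spec

theorem continuousAt_xy (p : C.AffinePart) : ContinuousAt C.xy (.affine p) := by
  rw [← C.isOpenEmbedding_affine.continuousAt_iff]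
  exact continuous_subtype_val.continuousAt

theorem xy_fst_infinity_chart (w : {w : ℂ // w ^ 2 = C.revPoly.eval 0}) (z : ℂ) :
    (C.xy ((C.chart (.infinity w)).symm z)).1 = (C.tw ((C.chart (.infinity w)).symm z)).1⁻¹ := by
  obtain ⟨q, hq⟩ := C.chart_infinity_symm w z
  rw [hq, C.xy_ofInfinityPart', C.tw_ofInfinityPart]

theorem xy_snd_infinity_chart (w : {w : ℂ // w ^ 2 = C.revPoly.eval 0}) (z : ℂ) :
    (C.xy ((C.chart (.infinity w)).symm z)).2 = (C.tw ((C.chart (.infinity w)).symm z)).2 *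
      ((C.tw ((C.chart (.infinity w)).symm z)).1 ^ (g + 1))⁻¹ := by
  obtain ⟨q, hq⟩ := C.chart_infinity_symm w z
  rw [hq, C.xy_ofInfinityPart', C.tw_ofInfinityPart, div_eq_mul_inv]

theorem meromorphicAt_tw (w : {w : ℂ // w ^ 2 = C.revPoly.eval 0}) :
    MeromorphicAt (fun z => (C.tw ((C.chart (.infinity w)).symm z)).1)
      (C.chart (.infinity w) (.infinity w)) ∧
    MeromorphicAt (fun z => (C.tw ((C.chart (.infinity w)).symm z)).2)
      (C.chart (.infinity w) (.infinity w)) :=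
  ⟨(analyticAt_fst.comp (C.analyticAt_tw w)).meromorphicAt,
    (analyticAt_snd.comp (C.analyticAt_tw w)).meromorphicAt⟩

theorem isMeromorphicFun_x : IsMeromorphicFun fun q => (C.xy q).1 := by
  rintro (p | w)
  · exact (analyticAt_fst.comp (C.analyticAt_xy p)).meromorphicAt
  · refine (C.meromorphicAt_tw w).1.inv.congr (Eventually.of_forall fun z => ?_)
    exact (C.xy_fst_infinity_chart w z).symm

theorem isMeromorphicFun_y : IsMeromorphicFun fun q => (C.xy q).2 := by
  rintro (p | w)
  · exact (analyticAt_snd.comp (C.analyticAt_xy p)).meromorphicAt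
  · refine ((C.meromorphicAt_tw w).2.mul ((C.meromorphicAt_tw w).1.pow (g + 1)).inv).congr
      (Eventually.of_forall fun z => ?_)
    exact (C.xy_snd_infinity_chart w z).symm

theorem orderAt_x_infinity (w : {w : ℂ // w ^ 2 = C.revPoly.eval 0}) :
    orderAt (fun q => (C.xy q).1) (.infinity w) = (-C.ramification (.infinity w) : ℤ) := by
  have h := (C.orders_infinity w).1
  have he : (fun q => (C.xy q).1) ∘ (chartAt ℂ (.infinity w : C.Surface)).symm =
      ((fun q => (C.tw q).1) ∘ (chartAt ℂ (.infinity w : C.Surface)).symm)⁻¹ :=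
    funext (C.xy_fst_infinity_chart w)
  rw [orderAt] at h ⊢
  rw [he, meromorphicOrderAt_inv, h]
  rfl

theorem orderAt_y_infinity (w : {w : ℂ // w ^ 2 = C.revPoly.eval 0}) :
    orderAt (fun q => (C.xy q).2) (.infinity w) =
      (C.ramification (.infinity w) - 1 - (g + 1) * C.ramification (.infinity w) : ℤ) := by
  obtain ⟨h1, h2⟩ := C.orders_infinity w
  have he : (fun q => (C.xy q).2) ∘ (chartAt ℂ (.infinity w : C.Surface)).symm =
      ((fun q => (C.tw q).2) ∘ (chartAt ℂ (.infinity w : C.Surface)).symm) *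
      (((fun q => (C.tw q).1) ∘ (chartAt ℂ (.infinity w : C.Surface)).symm) ^ (g + 1))⁻¹ :=
    funext (C.xy_snd_infinity_chart w)
  obtain ⟨m1, m2⟩ := C.meromorphicAt_tw w
  rw [orderAt] at h1 h2 ⊢
  rw [he]
  refine (meromorphicOrderAt_mul m2 (m1.pow _).inv).trans ?_
  rw [meromorphicOrderAt_inv, meromorphicOrderAt_pow m1]
  refine (congrArg₂ (fun a b : WithTop ℤ => a + -(((g + 1 : ℕ) : WithTop ℤ) * b)) h2 h1).trans ?_
  rw [sub_eq_add_neg _ ((g + 1 : ℤ) * _), WithTop.coe_add]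
  congr 1

theorem ramification_pos (p : C.Surface) : 0 < C.ramification p := by
  unfold ramification
  split_ifs <;> norm_num

theorem hasDivisor_x_sub (p : C.AffinePart) :
    HasDivisor (fun q => (C.xy q).1 - p.1.1) (C.fiber (.affine p) - C.fiber C.infPoint) := by
  have hm : IsMeromorphicFun fun q => (C.xy q).1 - p.1.1 := fun q =>
    (C.isMeromorphicFun_x q).sub (MeromorphicAt.const _ _)
  refine ⟨hm, ?_⟩
  rintro (q | w)
  · have hi : C.fiber C.infPoint (.affine q) = 0 :=
      C.fiber_apply_of_ne (by rw [proj_infPoint]; exact OnePoint.coe_ne_infty _)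
    rw [Finsupp.sub_apply, hi, sub_zero]
    by_cases h : q.1.1 = p.1.1
    · rw [C.fiber_apply_of_eq (by simp only [proj, h]), ← h]
      exact (C.orders_affine q).1
    · rw [C.fiber_apply_of_ne (by simpa only [proj, ne_eq, OnePoint.coe_eq_coe])]
      refine hm.orderAt_eq_zero_iff.2 ⟨q.1.1 - p.1.1, sub_ne_zero.2 h, ?_⟩
      exact ((C.continuousAt_xy q).fst.sub continuousAt_const).tendsto.mono_left nhdsWithin_le_nhds
  · rw [Finsupp.sub_apply, C.fiber_apply_of_ne (by exact OnePoint.infty_ne_coe _),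
      C.fiber_apply_of_eq (by rw [proj_infPoint]; rfl), zero_sub, ← C.orderAt_x_infinity]
    have h := meromorphicOrderAt_add_eq_left_of_lt
      (f₁ := (fun q => (C.xy q).1) ∘ (chartAt ℂ (.infinity w : C.Surface)).symm)
      (f₂ := fun _ => -p.1.1)
      (x := chartAt ℂ (.infinity w : C.Surface) (.infinity w)) (MeromorphicAt.const _ _) ?_
    · exact h
    · have h1 := C.orderAt_x_infinity w
      rw [orderAt] at h1
      rw [h1]
      refine lt_of_lt_of_le ?_ (analyticAt_const.meromorphicOrderAt_nonneg)
      have := C.ramification_pos (.infinity w)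
      exact_mod_cast neg_neg_of_pos this

theorem revPoly_eval_zero : C.revPoly.eval 0 = C.poly.coeff (2 * g + 2) := by
  rw [← coeff_zero_eq_eval_zero, revPoly, coeff_reflect, revAt_le (Nat.zero_le _), Nat.sub_zero]

theorem revPoly_eval_zero_eq_zero_iff : C.revPoly.eval 0 = 0 ↔ C.poly.natDegree = 2 * g + 1 := by
  rw [revPoly_eval_zero]
  have hm := C.monic.coeff_natDegree
  rcases C.natDegree_eq with h | h
  · exact ⟨fun _ => h, fun _ => coeff_eq_zero_of_natDegree_lt (by omega)⟩
  · rw [h] at hm ⊢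
    rw [hm]
    exact ⟨fun h => absurd h one_ne_zero, fun h => by omega⟩

/-- Weierstrass points are counted through this bijection, and it is what later turns real branch
points into points fixed by $\tau$. -/
theorem bijOn_proj : Set.BijOn C.proj {p | C.flip p = p} C.branchPoints := by
  refine ⟨?_, ?_, ?_⟩
  · rintro (p | w) h
    · have h0 : p.1.2 = 0 := (C.affine_flip_eq_iff p).1 h
      refine Or.inl ⟨p.1.1, ?_, rfl⟩
      rw [IsRoot, ← p.2, h0]
      simp
    · have h0 : w.1 = 0 := (C.infinity_flip_eq_iff w).1 h
      refine Or.inr ⟨rfl, C.revPoly_eval_zero_eq_zero_iff.1 ?_⟩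
      rw [← w.2, h0]
      simp
  · intro p hp q hq h
    rcases C.proj_eq_iff.1 h with h | h
    · exact h
    · exact h.trans hq
  · rintro e (⟨z, hz, rfl⟩ | ⟨rfl, hd⟩)
    · exact ⟨.affine ⟨(z, 0), by rw [hz.eq_zero]; simp⟩, (C.affine_flip_eq_iff _).2 rfl, rfl⟩
    · exact ⟨.infinity ⟨0, by rw [C.revPoly_eval_zero_eq_zero_iff.2 hd]; simp⟩,
        (C.infinity_flip_eq_iff _).2 rfl, rfl⟩

theorem branchPoints_finite_ncard : C.branchPoints.Finite ∧ C.branchPoints.ncard = 2 * g + 2 := by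
  classical
  have hcard : C.poly.roots.toFinset.card = C.poly.natDegree := by
    rw [Multiset.toFinset_card_of_nodup
      (nodup_roots (PerfectField.separable_iff_squarefree.2 C.squarefree))]
    exact splits_iff_card_roots.1 (IsAlgClosed.splits C.poly)
  set R : Finset (OnePoint ℂ) := C.poly.roots.toFinset.image (fun z : ℂ => (z : OnePoint ℂ)) with hR
  have hRc : R.card = C.poly.natDegree := by
    rw [hR, Finset.card_image_of_injective _ OnePoint.coe_injective, hcard]
  have hmem : ∀ e, e ∈ R ↔ ∃ z : ℂ, C.poly.IsRoot z ∧ e = (z : OnePoint ℂ) := fun e => by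
    simp only [hR, Finset.mem_image, Multiset.mem_toFinset, mem_roots C.monic.ne_zero, eq_comm]
  have hinf : OnePoint.infty ∉ R := by
    rw [hmem]
    rintro ⟨z, _, h⟩
    exact OnePoint.infty_ne_coe _ h
  rcases C.natDegree_eq with h | h
  · have : C.branchPoints = (insert OnePoint.infty R : Finset (OnePoint ℂ)) := by
      ext e
      rw [Finset.mem_coe, Finset.mem_insert, hmem]
      simp only [branchPoints, h, and_true, Set.mem_ofPred_eq]
      exact or_comm
    rw [this, Set.ncard_coe_finset, Finset.card_insert_of_notMem hinf, hRc, h]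
    exact ⟨Finset.finite_toSet _, rfl⟩
  · have : C.branchPoints = R := by
      ext e
      rw [Finset.mem_coe, hmem]
      simp only [branchPoints, h, Set.mem_ofPred_eq]
      refine ⟨?_, Or.inl⟩
      rintro (h | ⟨_, h⟩)
      · exact h
      · omega
    rw [this, Set.ncard_coe_finset, hRc, h]
    exact ⟨Finset.finite_toSet _, rfl⟩

theorem finite_flip_eq : {p | C.flip p = p}.Finite :=
  (C.bijOn_proj.finite_iff_finite).2 C.branchPoints_finite_ncard.1

/-- The points of the surface over the branch points. -/
noncomputable def weierstrass : Finset C.Surface := C.finite_flip_eq.toFinset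

theorem mem_weierstrass {p : C.Surface} : p ∈ C.weierstrass ↔ C.flip p = p :=
  C.finite_flip_eq.mem_toFinset

theorem card_weierstrass : C.weierstrass.card = 2 * g + 2 := by
  rw [← Set.ncard_coe_finset, weierstrass, Set.Finite.coe_toFinset,
    ← C.branchPoints_finite_ncard.2, ← C.bijOn_proj.image_eq, C.bijOn_proj.injOn.ncard_image]

/-- This is the one relation among the Weierstrass points beyond those coming from fibres. -/
theorem hasDivisor_y : HasDivisor (fun q => (C.xy q).2)
    (∑ W ∈ C.weierstrass, Finsupp.single W 1 - (g + 1 : ℤ) • C.fiber C.infPoint) := by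
  classical
  refine ⟨C.isMeromorphicFun_y, fun q => ?_⟩
  have hs : (∑ W ∈ C.weierstrass, Finsupp.single W (1 : ℤ)) q = C.ramification q - 1 := by
    rw [Finsupp.finsetSum_apply]
    simp only [Finsupp.single_apply]
    rw [Finset.sum_ite_eq']
    simp only [C.mem_weierstrass, ramification]
    split_ifs <;> rfl
  rw [Finsupp.sub_apply, Finsupp.smul_apply, hs, smul_eq_mul]
  cases q with
  | affine q =>
    rw [C.fiber_apply_of_ne (by rw [proj_infPoint]; exact OnePoint.coe_ne_infty _), mul_zero,
      sub_zero]
    exact (C.orders_affine q).2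
  | infinity w =>
    rw [C.fiber_apply_of_eq (by rw [proj_infPoint]; rfl)]
    exact C.orderAt_y_infinity w

theorem chartAt_flip_eventuallyEq (p : C.Surface) :
    (C.flip p = p ∧ chartAt ℂ (C.flip p) ∘ C.flip ∘ (chartAt ℂ p).symm =ᶠ[𝓝 (chartAt ℂ p p)]
      fun z => -z) ∨
    chartAt ℂ (C.flip p) ∘ C.flip ∘ (chartAt ℂ p).symm =ᶠ[𝓝 (chartAt ℂ p p)] id := by
  by_cases h : C.flip p = p
  · refine Or.inl ⟨h, ?_⟩
    filter_upwards [C.eventually_mem_target p] with z hz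
    exact (C.chart_flip p hz).trans (if_pos h)
  · refine Or.inr ?_
    filter_upwards [C.eventually_mem_target p] with z hz
    exact (C.chart_flip p hz).trans (if_neg h)

theorem hasDivisor_comp_flip {f : C.Surface → ℂ} {D : Divisor C.Surface} (hf : HasDivisor f D) :
    HasDivisor (f ∘ C.flip) (divisorMap C.flip D) := by
  have h := IsMeromorphicFun.comp C.continuous_flip (fun p => ?_) (fun p => ?_) hf.1
  · exact ⟨h.1, fun p => by rw [h.2, hf.2, divisorMap_apply C.flip_involutive]⟩
  · rcases C.chartAt_flip_eventuallyEq p with ⟨_, h⟩ | h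
    · exact analyticAt_id.neg.congr h.symm
    · exact analyticAt_id.congr h.symm
  · rcases C.chartAt_flip_eventuallyEq p with ⟨_, h⟩ | h
    · rw [h.deriv_eq, deriv_neg]
      norm_num
    · rw [h.deriv_eq, deriv_id]
      norm_num

/-- The parity of the order at a Weierstrass point of a function that the hyperelliptic involution
multiplies by a constant. -/
theorem eq_neg_one_zpow_of_comp_flip {f : C.Surface → ℂ} {D : Divisor C.Surface} {c : ℂ}
    (hf : HasDivisor f D) (hc : f ∘ C.flip =ᶠ[codiscrete C.Surface] fun q => c * f q)
    {p : C.Surface} (hp : C.flip p = p) : c = (-1) ^ D p := by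
  have hfl : ∀ᶠ z in 𝓝 (chartAt ℂ p p), C.flip ((chartAt ℂ p).symm z) = (chartAt ℂ p).symm (-z) := by
    have h1 := eventually_comp_chartAt_symm C.continuous_flip p
    filter_upwards [h1, C.eventually_mem_target p] with z hz1 hz2
    rw [← hz1]
    have h3 := (C.chart_flip p hz2).trans (if_pos hp)
    rw [hp] at h3 ⊢
    exact congrArg _ h3
  -- The involution reads $z\mapsto-z$ in this chart, so its fixed point has coordinate $0$.
  have hz0 : chartAt ℂ p p = 0 := by
    have h3 := (C.chart_flip p (C.eventually_mem_target p).self_of_nhds).trans (if_pos hp)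
    rw [C.chart_symm_self, hp] at h3
    exact self_eq_neg.1 h3
  obtain ⟨u, hu, hu0, hfu⟩ := (meromorphicOrderAt_eq_int_iff (hf.1 p)).1 (hf.2 p)
  have hneg : Tendsto (fun z : ℂ => -z) (𝓝[≠] 0) (𝓝[≠] 0) := by
    have := tendsto_nhdsNE_of_injective (continuous_neg (G := ℂ)) neg_injective 0
    rwa [neg_zero] at this
  have hcz := eventually_chartAt_symm.2 (eventuallyEq_codiscrete_iff.1 hc p)
  rw [hz0] at hfl hu hu0 hfu hcz
  -- With $f=z^n u$ and $u(0)\ne0$, the relation $f(-z)=c f(z)$ becomes $(-1)^n u(-z)=c\,u(z)$.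
  -- Letting $z\to0$ gives $c=(-1)^n$.
  have key : ∀ᶠ z in 𝓝[≠] (0 : ℂ), (-1) ^ D p * u (-z) = c * u z := by
    filter_upwards [hfu, hneg.eventually hfu, hcz, hfl.filter_mono nhdsWithin_le_nhds,
      self_mem_nhdsWithin] with z h1 h2 h3 h4 h5
    have hz : (z - 0 : ℂ) ^ D p ≠ 0 := zpow_ne_zero _ (by simpa using h5)
    simp only [Function.comp] at h1 h2 h3
    rw [h4, h2, h1, sub_zero, sub_zero, neg_eq_neg_one_mul, mul_zpow] at h3
    rw [sub_zero] at hz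
    refine mul_left_cancel₀ hz ?_
    simp only [smul_eq_mul] at h3
    rw [neg_eq_neg_one_mul z]
    linear_combination h3
  have hl1 : Tendsto (fun z => (-1) ^ D p * u (-z)) (𝓝[≠] (0 : ℂ)) (𝓝 ((-1) ^ D p * u 0)) :=
    ((hu.continuousAt.tendsto.mono_left nhdsWithin_le_nhds).comp hneg).const_mul _
  have hl2 : Tendsto (fun z => c * u z) (𝓝[≠] (0 : ℂ)) (𝓝 (c * u 0)) :=
    (hu.continuousAt.tendsto.mono_left nhdsWithin_le_nhds).const_mul _
  exact (mul_right_cancel₀ hu0 (tendsto_nhds_unique (hl1.congr' key) hl2)).symm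

theorem mdifferentiableAt_x (p : C.AffinePart) :
    MDifferentiableAt 𝓘(ℂ, ℂ) 𝓘(ℂ, ℂ) (fun q => (C.xy q).1) (.affine p : C.Surface) := by
  have h1 : MDifferentiableAt 𝓘(ℂ, ℂ) 𝓘(ℂ, ℂ)
      ((fun z => (C.xy ((C.chart (.affine p)).symm z)).1) ∘ C.chart (.affine p)) (.affine p) :=
    (analyticAt_fst.comp (C.analyticAt_xy p)).differentiableAt.mdifferentiableAt.comp _
      (mdifferentiableAt_atlas (chart_mem_atlas ℂ (.affine p : C.Surface)) (C.mem_chart_source _))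
  refine h1.congr_of_eventuallyEq ?_
  filter_upwards [(C.chart (.affine p)).open_source.mem_nhds (C.mem_chart_source _)] with q hq
  simp only [Function.comp, (C.chart (.affine p)).left_inv hq]

theorem eventually_symm_mem_range_affine (p : C.Surface) : ∀ᶠ z in 𝓝[≠] (chartAt ℂ p p),
    (chartAt ℂ p).symm z ∈ Set.range (Surface.affine (C := C)) := by
  cases p with
  | affine p => exact Eventually.of_forall fun z => ⟨_, (C.chart_affine_symm p z).choose_spec.symm⟩
  | infinity w =>
    have h := (meromorphicOrderAt_ne_top_iff_eventually_ne_zero (C.meromorphicAt_tw w).1).1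
      (ne_of_eq_of_ne (C.orders_infinity w).1 WithTop.coe_ne_top)
    filter_upwards [h] with z hz
    obtain ⟨q, hq⟩ := C.chart_infinity_symm w z
    rw [hq, C.tw_ofInfinityPart] at hz
    refine ⟨⟨(q.1.1⁻¹, q.1.2 / q.1.1 ^ (g + 1)), ?_⟩, ?_⟩
    · rw [div_pow, q.2, C.revPoly_eval hz]
      field_simp
      ring
    · refine Eq.trans ?_ hq.symm
      simp only [ofInfinityPart, hz, dite_false]

/-- The one-form `dx / y`. -/
noncomputable def dxDivY (q : C.Surface) : TangentSpace 𝓘(ℂ, ℂ) q →L[ℂ] ℂ :=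
  (C.xy q).2⁻¹ • mfderiv 𝓘(ℂ, ℂ) 𝓘(ℂ, ℂ) (fun q => (C.xy q).1) q

theorem formCoeff_dxDivY (p : C.Surface) : formCoeff C.dxDivY p =ᶠ[𝓝[≠] (chartAt ℂ p p)]
    ((fun q => (C.xy q).2) ∘ (chartAt ℂ p).symm)⁻¹ *
      deriv ((fun q => (C.xy q).1) ∘ (chartAt ℂ p).symm) := by
  filter_upwards [C.eventually_symm_mem_range_affine p,
    (C.eventually_mem_target p).filter_mono nhdsWithin_le_nhds] with z ⟨q, hq⟩ hz
  have h1 : MDifferentiableAt 𝓘(ℂ, ℂ) 𝓘(ℂ, ℂ) (fun q => (C.xy q).1) ((chartAt ℂ p).symm z) := by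
    rw [← hq]
    exact C.mdifferentiableAt_x q
  have h2 : MDifferentiableAt 𝓘(ℂ, ℂ) 𝓘(ℂ, ℂ) (chartAt ℂ p).symm z :=
    mdifferentiableAt_atlas_symm (chart_mem_atlas ℂ p) hz
  have h3 := mfderiv_comp z h1 h2
  rw [mfderiv_eq_fderiv] at h3
  have h4 : deriv ((fun q => (C.xy q).1) ∘ (chartAt ℂ p).symm) z =
      (mfderiv 𝓘(ℂ, ℂ) 𝓘(ℂ, ℂ) (fun q => (C.xy q).1) ((chartAt ℂ p).symm z))
        (mfderiv 𝓘(ℂ, ℂ) 𝓘(ℂ, ℂ) (chartAt ℂ p).symm z (1 : ℂ)) :=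
    congrArg (fun L : ℂ →L[ℂ] ℂ => L 1) h3
  rw [Pi.mul_apply, h4]
  rfl

/-- With $e$ the ramification index, $dx$ and $y$ both have order $e-1$ at affine points. Over
infinity $dx$ has order $-e-1$ and $y$ has order $e-1-(g+1)e$, so $dx/y$ has order $(g-1)e$. -/
theorem isCanonical_fiber : IsCanonical ((g - 1 : ℤ) • C.fiber C.infPoint) := by
  refine ⟨C.dxDivY, fun p => ?_⟩
  have hy := C.isMeromorphicFun_y p
  have hx := C.isMeromorphicFun_x p
  refine ⟨(hy.inv.mul hx.deriv).congr (C.formCoeff_dxDivY p).symm, ?_⟩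
  rw [meromorphicOrderAt_congr (C.formCoeff_dxDivY p), meromorphicOrderAt_mul hy.inv hx.deriv,
    meromorphicOrderAt_inv, Finsupp.smul_apply, smul_eq_mul]
  have hpos := C.ramification_pos p
  cases p with
  | affine p =>
    obtain ⟨h1, h2⟩ := C.orders_affine p
    have h3 := meromorphicOrderAt_deriv_eq_sub_one (𝕜 := ℂ) (by exact_mod_cast hpos.ne') h1
    have h4 : deriv ((fun q => (C.xy q).1 - p.1.1) ∘ (chartAt ℂ (.affine p : C.Surface)).symm) =
        deriv ((fun q => (C.xy q).1) ∘ (chartAt ℂ (.affine p : C.Surface)).symm) :=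
      funext fun z => deriv_sub_const (f := (fun q => (C.xy q).1) ∘ (chartAt ℂ (.affine p : C.Surface)).symm) _
    rw [h4] at h3
    rw [h3, show meromorphicOrderAt _ _ = _ from h2,
      C.fiber_apply_of_ne (by rw [proj_infPoint]; exact OnePoint.coe_ne_infty _)]
    rw [← WithTop.LinearOrderedAddCommGroup.coe_neg, ← WithTop.coe_add]
    congr 1
    ring
  | infinity w =>
    have h3 := meromorphicOrderAt_deriv_eq_sub_one (𝕜 := ℂ)
      (by exact_mod_cast (neg_neg_of_pos hpos).ne) (C.orderAt_x_infinity w)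
    rw [h3, show meromorphicOrderAt _ _ = _ from C.orderAt_y_infinity w,
      C.fiber_apply_of_eq (by rw [proj_infPoint]; rfl),
      ← WithTop.LinearOrderedAddCommGroup.coe_neg, ← WithTop.coe_add]
    congr 1
    ring

end HyperellipticEquation

/-! ### Subset sums of two-torsion elements -/

section TwoTorsionSums

variable {ι G : Type*} [DecidableEq ι] [AddCommGroup G] {f : ι → G}

/-- Common terms cancel in pairs. Subset sums thus turn symmetric difference into addition, so
injectivity on subsets reduces to a trivial kernel. -/
theorem sum_add_sum_eq_sum_symmDiff {s t : Finset ι} (hf : ∀ i ∈ s, f i + f i = 0) :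
    ∑ i ∈ s, f i + ∑ i ∈ t, f i = ∑ i ∈ symmDiff s t, f i := by
  have h0 : ∑ i ∈ s ∩ t, f i + ∑ i ∈ s ∩ t, f i = 0 := by
    rw [← Finset.sum_add_distrib]
    exact Finset.sum_eq_zero fun i hi => hf i (Finset.mem_inter.1 hi).1
  rw [symmDiff_def, Finset.sup_eq_union, Finset.sum_union disjoint_sdiff_sdiff,
    ← Finset.sum_inter_add_sum_sdiff s t f, ← Finset.sum_inter_add_sum_sdiff t s f,
    Finset.inter_comm t s]
  calc _ = (∑ i ∈ s ∩ t, f i + ∑ i ∈ s ∩ t, f i) + (∑ i ∈ s \ t, f i + ∑ i ∈ t \ s, f i) := by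
        abel
    _ = _ := by rw [h0, zero_add]

theorem exists_sum_eq_of_mem_closure {s : Finset ι} (hf : ∀ i ∈ s, f i + f i = 0) {x : G}
    (hx : x ∈ AddSubgroup.closure (f '' s)) : ∃ t ⊆ s, x = ∑ i ∈ t, f i := by
  induction hx using AddSubgroup.closure_induction with
  | mem x hx =>
    obtain ⟨i, hi, rfl⟩ := hx
    exact ⟨{i}, by simpa using hi, by simp⟩
  | zero => exact ⟨∅, by simp, by simp⟩
  | add x y _ _ hx hy =>
    obtain ⟨t, ht, rfl⟩ := hx
    obtain ⟨u, hu, rfl⟩ := hy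
    refine ⟨symmDiff t u, ?_, sum_add_sum_eq_sum_symmDiff fun i hi => hf i (ht hi)⟩
    exact (symmDiff_le_sup (a := t) (b := u)).trans (Finset.union_subset ht hu)
  | neg x _ hx =>
    obtain ⟨t, ht, rfl⟩ := hx
    refine ⟨t, ht, ?_⟩
    rw [neg_eq_iff_add_eq_zero, ← Finset.sum_add_distrib]
    exact Finset.sum_eq_zero fun i hi => hf i (ht hi)

end TwoTorsionSums

/-! ### The divisor class group -/

section RiemannSurface

variable (X : Type*) [TopologicalSpace X] [ChartedSpace ℂ X]

/-- The divisor class group, as a type of its own. -/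
def PicardGroup : Type _ := DivisorClass X

noncomputable instance : AddCommGroup (PicardGroup X) := inferInstanceAs (AddCommGroup (DivisorClass X))

/-- The class of a divisor. -/
noncomputable def divisorClass : Divisor X →+ PicardGroup X :=
  QuotientAddGroup.mk' (principalDivisors X)

variable {X}

theorem divisorClass_eq_zero_iff {D : Divisor X} :
    divisorClass X D = 0 ↔ ∃ f : X → ℂ, HasDivisor f D :=
  QuotientAddGroup.eq_zero_iff D

theorem divisorClass_eq_iff {D E : Divisor X} :
    divisorClass X D = divisorClass X E ↔ LinEquiv D E := by
  rw [← sub_eq_zero, ← map_sub, divisorClass_eq_zero_iff]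
  rfl

theorem divisorClass_surjective : Function.Surjective (divisorClass X) :=
  QuotientAddGroup.mk'_surjective _

theorem map_eq_sum_smul {G : Type*} [AddCommGroup G] {Y : Type*} (φ : Divisor Y →+ G)
    (D : Divisor Y) : φ D = D.sum fun p n => n • φ (Finsupp.single p 1) := by
  conv_lhs => rw [← D.sum_single]
  rw [Finsupp.sum, map_sum]
  refine Finset.sum_congr rfl fun p _ => ?_
  beta_reduce
  rw [← map_zsmul, Finsupp.smul_single, smul_eq_mul, mul_one]

end RiemannSurface

/-! ### Degrees and two-torsion in the divisor class group of the surface -/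

namespace HyperellipticEquation

variable {g : ℕ} (C : HyperellipticEquation g)

theorem divisorClass_fiber (p : C.Surface) : divisorClass C.Surface (C.fiber p) =
    divisorClass C.Surface (C.fiber C.infPoint) := by
  cases p with
  | affine p => exact divisorClass_eq_iff.2 ⟨_, C.hasDivisor_x_sub p⟩
  | infinity w =>
    congr 1
    ext q
    by_cases h : C.proj q = OnePoint.infty
    · rw [C.fiber_apply_of_eq (by rw [h]; rfl), C.fiber_apply_of_eq (by rw [h, proj_infPoint])]
    · rw [C.fiber_apply_of_ne (by exact h), C.fiber_apply_of_ne (by rwa [proj_infPoint])]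

/-- Each point together with its flip forms a fibre, and all fibres are equivalent. -/
theorem divisorClass_add_flip (D : Divisor C.Surface) :
    divisorClass C.Surface (D + divisorMap C.flip D) =
      D.degree • divisorClass C.Surface (C.fiber C.infPoint) := by
  induction D using Finsupp.induction_linear with
  | zero => simp
  | add D E hD hE =>
    have : D + E + divisorMap C.flip (D + E) =
        (D + divisorMap C.flip D) + (E + divisorMap C.flip E) := by
      rw [map_add]
      abel
    rw [this, map_add, hD, hE, map_add, add_smul]
  | single p n =>
    have : Finsupp.single p n + divisorMap C.flip (Finsupp.single p n) = n • C.fiber p := by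
      rw [divisorMap_single, fiber, smul_add, Finsupp.smul_single, Finsupp.smul_single,
        smul_eq_mul, mul_one]
    rw [this, map_zsmul, divisorClass_fiber, Finsupp.degree_single]

/-- For $n\ge0$ a function with divisor $n\cdot\text{fibre}$ has no poles, so it is constant and its
divisor vanishes. This replaces the residue theorem in the proof that principal divisors have degree
zero. -/
theorem nsmul_fiber_eq_zero {n : ℤ} (hn : 0 ≤ n)
    (h : n • divisorClass C.Surface (C.fiber C.infPoint) = 0) : n = 0 := by
  rw [← map_zsmul] at h
  obtain ⟨f, hf⟩ := divisorClass_eq_zero_iff.1 h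
  have happ : ∀ q, (n • C.fiber C.infPoint) q = n * C.fiber C.infPoint q := fun q => rfl
  have hnn : ∀ p, 0 ≤ orderAt f p := fun p => by
    rw [hf.2, happ]
    by_cases hp : C.proj p = C.proj C.infPoint
    · rw [C.fiber_apply_of_eq hp]
      exact_mod_cast mul_nonneg hn (C.ramification_pos p).le
    · rw [C.fiber_apply_of_ne hp, mul_zero]
      rfl
  obtain ⟨c, hc⟩ := hf.1.eq_const_of_orderAt_nonneg hnn
  have hc0 : c ≠ 0 := by
    rintro rfl
    have := (eventuallyEq_codiscrete_iff.1 hc C.infPoint).and (hf.eventually_ne_zero C.infPoint)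
    obtain ⟨q, h1, h2⟩ := this.exists
    exact h2 h1
  have := DFunLike.congr_fun ((hf.congr hc).unique (HasDivisor.const hc0)) C.infPoint
  rw [happ, C.fiber_apply_of_eq rfl, Finsupp.zero_apply] at this
  exact (mul_eq_zero.1 this).resolve_right (C.ramification_pos _).ne'

/-- Principal divisors have degree zero. -/
theorem degree_eq_zero {D : Divisor C.Surface} (hD : D ∈ principalDivisors C.Surface) :
    D.degree = 0 := by
  obtain ⟨f, hf⟩ := hD
  -- The product $f\cdot(f\circ\mathrm{flip})$ shows that $D+\mathrm{flip}(D)$ is principal.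
  have h : D.degree • divisorClass C.Surface (C.fiber C.infPoint) = 0 := by
    rw [← C.divisorClass_add_flip]
    exact divisorClass_eq_zero_iff.2 ⟨_, hf.mul (C.hasDivisor_comp_flip hf)⟩
  rcases le_total 0 D.degree with h0 | h0
  · exact C.nsmul_fiber_eq_zero h0 h
  · have := C.nsmul_fiber_eq_zero (n := -D.degree) (by omega) (by rw [neg_smul, h, neg_zero])
    omega

/-- The class of `p - W₀`. -/
noncomputable def pointClass (W₀ p : C.Surface) : PicardGroup C.Surface :=
  divisorClass C.Surface (Finsupp.single p 1) - divisorClass C.Surface (Finsupp.single W₀ 1)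

variable {C}

theorem divisorClass_single_add_single {W : C.Surface} (hW : C.flip W = W) :
    divisorClass C.Surface (Finsupp.single W 1) + divisorClass C.Surface (Finsupp.single W 1) =
      divisorClass C.Surface (C.fiber C.infPoint) := by
  rw [← C.divisorClass_fiber W, fiber, hW, map_add]

theorem pointClass_add_self {W₀ W : C.Surface} (hW₀ : C.flip W₀ = W₀) (hW : C.flip W = W) :
    C.pointClass W₀ W + C.pointClass W₀ W = 0 := by
  rw [pointClass, sub_add_sub_comm, divisorClass_single_add_single hW,
    divisorClass_single_add_single hW₀, sub_self]

theorem sum_pointClass (W₀ : C.Surface) (S : Finset C.Surface) :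
    ∑ W ∈ S, C.pointClass W₀ W = divisorClass C.Surface
      (∑ W ∈ S, Finsupp.single W 1 - (S.card : ℤ) • Finsupp.single W₀ 1) := by
  rw [map_sub, map_sum, map_zsmul, natCast_zsmul]
  simp only [pointClass, Finset.sum_sub_distrib, Finset.sum_const]

theorem sum_pointClass_weierstrass {W₀ : C.Surface} (hW₀ : C.flip W₀ = W₀) :
    ∑ W ∈ C.weierstrass, C.pointClass W₀ W = 0 := by
  rw [sum_pointClass, map_sub, map_zsmul, C.card_weierstrass]
  have h := divisorClass_eq_zero_iff.2 ⟨_, C.hasDivisor_y⟩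
  rw [map_sub, map_zsmul, sub_eq_zero, ← divisorClass_single_add_single hW₀] at h
  rw [h, sub_eq_zero]
  push_cast
  module

open Classical in
/-- There are no relations between the classes `W - W₀` of the Weierstrass points `W` other than
`W₀` and one more point `W₁`. -/
theorem eq_empty_of_sum_pointClass_eq_zero {W₀ W₁ : C.Surface} (hW₀ : C.flip W₀ = W₀)
    (hW₁ : C.flip W₁ = W₁) (hne : W₁ ≠ W₀) {S : Finset C.Surface}
    (hS : S ⊆ (C.weierstrass.erase W₀).erase W₁) (h : ∑ W ∈ S, C.pointClass W₀ W = 0) :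
    S = ∅ := by
  rw [sum_pointClass] at h
  set E : Divisor C.Surface := ∑ W ∈ S, Finsupp.single W 1 - (S.card : ℤ) • Finsupp.single W₀ 1
    with hE
  have hEapp : ∀ q, q ≠ W₀ → E q = if q ∈ S then 1 else 0 := fun q hq => by
    rw [hE, Finsupp.sub_apply, Finsupp.finsetSum_apply, Finsupp.smul_apply,
      Finsupp.single_eq_of_ne hq, smul_zero, sub_zero]
    simp only [Finsupp.single_apply]
    rw [Finset.sum_ite_eq']
  have hflip : divisorMap C.flip E = E := by
    rw [hE, map_sub, map_zsmul, map_sum, divisorMap_single, hW₀]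
    congr 1
    refine Finset.sum_congr rfl fun W hW => ?_
    rw [divisorMap_single, C.mem_weierstrass.1
      (Finset.mem_of_mem_erase (Finset.mem_of_mem_erase (hS hW)))]
  obtain ⟨f, hf⟩ := divisorClass_eq_zero_iff.1 h
  -- The divisor is invariant, so $(f\circ\mathrm{flip})/f$ has trivial divisor and is a constant,
  -- the eigenvalue of $f$.
  have hq := (C.hasDivisor_comp_flip hf).mul hf.inv
  rw [hflip, add_neg_cancel] at hq
  obtain ⟨c, -, hc⟩ := hq.eq_const
  have hfc : f ∘ C.flip =ᶠ[codiscrete C.Surface] fun q => c * f q := by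
    refine eventuallyEq_codiscrete_iff.2 fun p => ?_
    filter_upwards [eventuallyEq_codiscrete_iff.1 hc p, hf.eventually_ne_zero p] with q h1 h2
    rw [← h1, Pi.mul_apply, Pi.inv_apply, inv_mul_cancel_right₀ h2]
  by_contra hSne
  obtain ⟨W, hW⟩ := Finset.nonempty_iff_ne_empty.2 hSne
  have hW' := hS hW
  rw [Finset.mem_erase, Finset.mem_erase] at hW'
  -- At the omitted point $W_1$ the order is $0$, giving eigenvalue $1$; at a point of $S$ the order
  -- is $1$, giving $-1$.
  have h1 := C.eq_neg_one_zpow_of_comp_flip hf hfc hW₁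
  have h2 := C.eq_neg_one_zpow_of_comp_flip hf hfc (C.mem_weierstrass.1 hW'.2.2)
  rw [hEapp _ hne, if_neg (fun h => (Finset.mem_erase.1 (hS h)).1 rfl), zpow_zero] at h1
  rw [hEapp _ hW'.2.1, if_pos hW, zpow_one, h1] at h2
  norm_num at h2

theorem pointClass_mem_closure [DecidableEq C.Surface] {W₀ W₁ W : C.Surface}
    (hW₀ : C.flip W₀ = W₀) (hW₁ : C.flip W₁ = W₁) (hne : W₁ ≠ W₀) (hW : C.flip W = W) :
    C.pointClass W₀ W ∈ AddSubgroup.closure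
      (C.pointClass W₀ '' ((C.weierstrass.erase W₀).erase W₁ : Finset C.Surface)) := by
  set H := AddSubgroup.closure
      (C.pointClass W₀ '' ((C.weierstrass.erase W₀).erase W₁ : Finset C.Surface)) with hH
  have hmem : ∀ V ∈ (C.weierstrass.erase W₀).erase W₁, C.pointClass W₀ V ∈ H := fun V hV =>
    AddSubgroup.subset_closure ⟨V, hV, rfl⟩
  have hzero : C.pointClass W₀ W₀ = 0 := sub_self _
  by_cases h0 : W = W₀
  · rw [h0, hzero]
    exact H.zero_mem
  by_cases h1 : W = W₁
  -- The relation from the divisor of $y$ expresses the class of $W_1$ through the other points.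
  · have hs := sum_pointClass_weierstrass hW₀
    rw [← Finset.sum_erase_add _ _ (C.mem_weierstrass.2 hW₀), hzero, add_zero,
      ← Finset.sum_erase_add _ _ (Finset.mem_erase.2 ⟨hne, C.mem_weierstrass.2 hW₁⟩),
      add_eq_zero_iff_neg_eq] at hs
    rw [h1, ← hs]
    exact H.neg_mem (H.sum_mem hmem)
  · exact hmem W (Finset.mem_erase.2 ⟨h1, Finset.mem_erase.2 ⟨h0, C.mem_weierstrass.2 hW⟩⟩)

/-- Induction on the size of the support: a point not fixed by the flip occurs with the same
multiplicity as its flip, so a multiple of their fibre can be removed. A fibre is equivalent to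
$2W_0$, and only Weierstrass points remain at the end. -/
theorem divisorClass_sub_mem_of_flip_eq {H : AddSubgroup (PicardGroup C.Surface)}
    {W₀ : C.Surface} (hW₀ : C.flip W₀ = W₀) (hH : ∀ W, C.flip W = W → C.pointClass W₀ W ∈ H)
    (n : ℕ) (D : Divisor C.Surface) (hn : D.support.card = n) (hD : divisorMap C.flip D = D) :
    divisorClass C.Surface D - D.degree • divisorClass C.Surface (Finsupp.single W₀ 1) ∈ H := by
  classical
  induction n using Nat.strong_induction_on generalizing D with
  | _ n ih =>
  by_cases hall : ∀ p ∈ D.support, C.flip p = p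
  · have : divisorClass C.Surface D - D.degree • divisorClass C.Surface (Finsupp.single W₀ 1) =
        ∑ p ∈ D.support, D p • C.pointClass W₀ p := by
      simp only [pointClass, smul_sub, Finset.sum_sub_distrib]
      rw [map_eq_sum_smul (divisorClass C.Surface) D, Finsupp.sum, Finsupp.degree_apply,
        Finset.sum_smul]
    rw [this]
    exact H.sum_mem fun p hp => H.zsmul_mem (hH p (hall p hp)) _
  · push Not at hall
    obtain ⟨p, hp, hpf⟩ := hall
    set D' := D - D p • C.fiber p with hD'
    have hDf : ∀ q, D (C.flip q) = D q := fun q => by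
      rw [← divisorMap_apply C.flip_involutive, hD]
    have hpp : C.fiber p p = 1 := by
      rw [C.fiber_apply_of_eq rfl, ramification, if_neg hpf]
    have hsub : D'.support ⊆ D.support.erase p := by
      intro q hq
      rw [Finsupp.mem_support_iff, hD', Finsupp.sub_apply, Finsupp.smul_apply, smul_eq_mul] at hq
      rw [Finset.mem_erase, Finsupp.mem_support_iff]
      refine ⟨?_, fun h0 => ?_⟩
      · rintro rfl
        rw [hpp, mul_one, sub_self] at hq
        exact hq rfl
      · rw [h0, zero_sub, neg_ne_zero] at hq
        have hpr : C.proj q = C.proj p := by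
          by_contra hpr
          rw [C.fiber_apply_of_ne hpr, mul_zero] at hq
          exact hq rfl
        rw [Finsupp.mem_support_iff] at hp
        rcases C.proj_eq_iff.1 hpr with rfl | rfl
        · exact hp h0
        · rw [hDf] at h0
          exact hp h0
    have hlt : D'.support.card < n := by
      rw [← hn]
      exact (Finset.card_le_card hsub).trans_lt (Finset.card_erase_lt_of_mem hp)
    have hfib : divisorMap C.flip (C.fiber p) = C.fiber p := by
      rw [fiber, map_add, divisorMap_single, divisorMap_single, C.flip_involutive, add_comm]
    have := ih _ hlt D' rfl (by rw [hD', map_sub, map_zsmul, hD, hfib])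
    convert this using 1
    rw [hD', map_sub, map_zsmul, map_sub, map_zsmul, C.divisorClass_fiber, C.degree_fiber,
      ← divisorClass_single_add_single hW₀, smul_eq_mul]
    module

theorem divisorClass_flip {D : Divisor C.Surface} (hD : D.degree = 0) :
    divisorClass C.Surface (divisorMap C.flip D) = - divisorClass C.Surface D := by
  have h := C.divisorClass_add_flip D
  rw [hD, zero_smul, map_add] at h
  exact (neg_eq_of_add_eq_zero_right h).symm

theorem degree_eq_zero_of_add_self {D : Divisor C.Surface}
    (hD : divisorClass C.Surface D + divisorClass C.Surface D = 0) : D.degree = 0 := by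
  rw [← map_add] at hD
  have := C.degree_eq_zero (divisorClass_eq_zero_iff.1 hD)
  rw [map_add] at this
  omega

/-- A two-torsion class contains a divisor that is invariant under the hyperelliptic involution. -/
theorem exists_flip_eq_of_add_self {D : Divisor C.Surface}
    (hD : divisorClass C.Surface D + divisorClass C.Surface D = 0) :
    ∃ D' : Divisor C.Surface, divisorMap C.flip D' = D' ∧
      divisorClass C.Surface D' = divisorClass C.Surface D := by
  -- The flip acts as $-1$ in degree zero, and $-1$ is the identity on two-torsion.
  have hJ : divisorClass C.Surface (divisorMap C.flip D) = divisorClass C.Surface D := by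
    rw [divisorClass_flip (degree_eq_zero_of_add_self hD), neg_eq_of_add_eq_zero_right hD]
  obtain ⟨h, hh⟩ := divisorClass_eq_iff.1 hJ
  have h1 := hh.mul (C.hasDivisor_comp_flip hh)
  rw [map_sub, divisorMap_divisorMap C.flip_involutive, ← neg_sub, neg_add_cancel] at h1
  obtain ⟨c, hc0, hc⟩ := h1.eq_const
  -- Dividing `h` by a square root of the constant $h\cdot(h\circ\mathrm{flip})$ yields $k$ with
  -- $k\cdot(k\circ\mathrm{flip})=1$, the norm-one condition of Hilbert 90.
  obtain ⟨r, hr⟩ := IsAlgClosed.exists_pow_nat_eq c (n := 2) (by norm_num)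
  have hr0 : r ≠ 0 := by
    rintro rfl
    rw [zero_pow two_ne_zero] at hr
    exact hc0 hr.symm
  have hk := (HasDivisor.const (X := C.Surface) (inv_ne_zero hr0)).mul hh
  rw [zero_add] at hk
  set k : C.Surface → ℂ := (fun _ => r⁻¹) * h with hkdef
  have hkk : ∀ p, ∀ᶠ q in 𝓝[≠] p, k q * k (C.flip q) = 1 := fun p => by
    filter_upwards [eventuallyEq_codiscrete_iff.1 hc p] with q hq
    simp only [Pi.mul_apply, Function.comp] at hq
    simp only [hkdef, Pi.mul_apply]
    have h2 : r⁻¹ * r⁻¹ * c = 1 := by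
      rw [← hr]
      field_simp
    linear_combination h2 + r⁻¹ * r⁻¹ * hq
  -- The Hilbert 90 solution is $u=1+k$, since $k\cdot(u\circ\mathrm{flip})=k+1=u$. Adding the
  -- divisor of $u$ to $D$ makes it invariant. The formula fails only for $k=-1$, and then $D$ is
  -- already invariant.
  have hu : IsMeromorphicFun ((fun _ => 1) + k) := (IsMeromorphicFun.const 1).add hk.1
  by_cases htop : ∀ p, orderAt ((fun _ => 1) + k) p = ⊤
  · have hk1 : k =ᶠ[codiscrete C.Surface] fun _ => -1 :=
      eventuallyEq_codiscrete_iff.2 fun p => by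
        filter_upwards [orderAt_eq_top_iff.1 (htop p)] with q hq
        exact (neg_eq_of_add_eq_zero_right hq).symm
    have := (hk.congr hk1).unique (HasDivisor.const (by norm_num))
    exact ⟨D, sub_eq_zero.1 this, rfl⟩
  · push Not at htop
    obtain ⟨p, hp⟩ := htop
    obtain ⟨E, hE⟩ := hu.exists_hasDivisor hp
    have h2 := hk.mul (C.hasDivisor_comp_flip hE)
    have hEE : E = divisorMap C.flip D - D + divisorMap C.flip E := by
      refine hE.unique (h2.congr (eventuallyEq_codiscrete_iff.2 fun p => ?_))
      filter_upwards [hkk p] with q hq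
      simp only [Pi.mul_apply, Pi.add_apply, Function.comp, mul_add, hq]
      ring
    refine ⟨D + E, ?_, ?_⟩
    · rw [map_add]
      conv_rhs => rw [hEE]
      abel
    · rw [map_add, divisorClass_eq_zero_iff.2 ⟨_, hE⟩, add_zero]

open Classical in
/-- The two-torsion classes are the sums of classes `W - W₀` of Weierstrass points. -/
theorem exists_sum_pointClass_eq {W₀ W₁ : C.Surface} (hW₀ : C.flip W₀ = W₀)
    (hW₁ : C.flip W₁ = W₁) (hne : W₁ ≠ W₀) {c : PicardGroup C.Surface} (hc : c + c = 0) :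
    ∃ S ⊆ (C.weierstrass.erase W₀).erase W₁, c = ∑ W ∈ S, C.pointClass W₀ W := by
  obtain ⟨D₀, rfl⟩ := divisorClass_surjective c
  obtain ⟨D, hD, hDD⟩ := exists_flip_eq_of_add_self hc
  rw [← hDD] at hc ⊢
  have h := divisorClass_sub_mem_of_flip_eq hW₀
    (fun W hW => pointClass_mem_closure hW₀ hW₁ hne hW) _ D rfl hD
  rw [degree_eq_zero_of_add_self hc, zero_smul, sub_zero] at h
  exact exists_sum_eq_of_mem_closure (fun W hW => pointClass_add_self hW₀ (C.mem_weierstrass.1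
    (Finset.mem_of_mem_erase (Finset.mem_of_mem_erase hW)))) h

end HyperellipticEquation

/-! ### Counting invariant subsets and elementary abelian two-groups -/

/-- The number of subsets of a finite set that are invariant under an involution. -/
theorem card_invariant_powerset {α : Type*} [DecidableEq α] {σ : α → α}
    (hσ : Function.Involutive σ) {s : Finset α} (hs : ∀ x ∈ s, σ x ∈ s) {m : ℕ}
    (hm : 2 * m = s.card + (s.filter fun x => σ x = x).card) :
    (s.powerset.filter fun t => t.image σ = t).card = 2 ^ m := by
  -- An arbitrary linear order selects the smaller element of each orbit. An invariant subset is
  -- determined by the selected elements it contains, and any set of selected elements occurs.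
  have : DecidableRel (WellOrderingRel (α := α)) := Classical.decRel _
  let _ : LinearOrder α := linearOrderOfSTO WellOrderingRel
  have hinv : ∀ {t : Finset α}, t.image σ = t ↔ ∀ x ∈ t, σ x ∈ t := fun {t} => by
    constructor
    · intro h x hx
      exact h ▸ Finset.mem_image_of_mem σ hx
    · intro h
      ext x
      rw [Finset.mem_image]
      constructor
      · rintro ⟨y, hy, rfl⟩
        exact h y hy
      · intro hx
        exact ⟨σ x, h x hx, hσ x⟩
  have hlt : (s.filter fun x => x < σ x).card = (s.filter fun x => σ x < x).card :=
    Finset.card_nbij' σ σ (by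
        intro x hx
        simp only [Finset.coe_filter, Set.mem_ofPred_eq] at hx ⊢
        exact ⟨hs x hx.1, by rw [hσ x]; exact hx.2⟩) (by
        intro x hx
        simp only [Finset.coe_filter, Set.mem_ofPred_eq] at hx ⊢
        exact ⟨hs x hx.1, by rw [hσ x]; exact hx.2⟩) (fun x _ => hσ x) (fun x _ => hσ x)
  -- This is the number of orbits: half the non-fixed points plus the fixed points.
  have hU : (s.filter fun x => x ≤ σ x).card = m := by
    have h1 := Finset.card_filter_add_card_filter_not (s := s) (fun x => x ≤ σ x)
    have h2 : (s.filter fun x => x ≤ σ x).card =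
        (s.filter fun x => x < σ x).card + (s.filter fun x => σ x = x).card := by
      rw [← Finset.card_union_of_disjoint]
      · congr 1
        ext x
        simp only [Finset.mem_filter, Finset.mem_union, le_iff_lt_or_eq, eq_comm (a := x),
          ← and_or_left]
      · rw [Finset.disjoint_filter]
        intro x _ h1 h2
        exact h1.ne' h2
    simp only [not_le] at h1
    omega
  rw [← hU, ← Finset.card_powerset]
  refine Finset.card_nbij' (fun t => t.filter fun x => x ≤ σ x) (fun t => t ∪ t.image σ) ?_ ?_ ?_ ?_
  · intro t ht
    simp only [Finset.coe_filter, Finset.mem_powerset, Set.mem_ofPred_eq] at ht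
    simp only [Finset.coe_powerset, Set.mem_preimage, Set.mem_powerset_iff, Finset.coe_subset]
    exact Finset.filter_subset_filter _ ht.1
  · intro t ht
    simp only [Finset.coe_powerset, Set.mem_preimage, Set.mem_powerset_iff, Finset.coe_subset] at ht
    simp only [Finset.coe_filter, Finset.mem_powerset, Set.mem_ofPred_eq]
    have hts : t ⊆ s := ht.trans (Finset.filter_subset _ _)
    refine ⟨Finset.union_subset hts ?_, ?_⟩
    · rw [Finset.image_subset_iff]
      exact fun x hx => hs x (hts hx)
    · rw [Finset.image_union, Finset.image_image, hσ.comp_self, Finset.image_id, Finset.union_comm]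
  · intro t ht
    simp only [Finset.coe_filter, Finset.mem_powerset, Set.mem_ofPred_eq] at ht
    have h := hinv.1 ht.2
    ext x
    simp only [Finset.mem_union, Finset.mem_filter, Finset.mem_image]
    constructor
    · rintro (hx | ⟨y, hy, rfl⟩)
      · exact hx.1
      · exact h y hy.1
    · intro hx
      rcases le_total x (σ x) with h1 | h1
      · exact Or.inl ⟨hx, h1⟩
      · exact Or.inr ⟨σ x, ⟨h x hx, by rwa [hσ x]⟩, hσ x⟩
  · intro t ht
    simp only [Finset.coe_powerset, Set.mem_preimage, Set.mem_powerset_iff, Finset.coe_subset] at ht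
    ext x
    simp only [Finset.mem_union, Finset.mem_filter, Finset.mem_image]
    constructor
    · rintro ⟨hx | ⟨y, hy, rfl⟩, hle⟩
      · exact hx
      · rw [hσ y] at hle
        have := (Finset.mem_filter.1 (ht hy)).2
        rwa [le_antisymm hle this]
    · intro hx
      exact ⟨Or.inl hx, (Finset.mem_filter.1 (ht hx)).2⟩

/-- Such a group is an $\mathbb F_2$-vector space, and its cardinality determines its dimension. -/
theorem nonempty_addEquiv_of_card {G : Type*} [AddCommGroup G] (hG : ∀ x : G, x + x = 0) {n : ℕ}
    (hn : Nat.card G = 2 ^ n) : Nonempty (G ≃+ (Fin n → ZMod 2)) := by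
  let _ : Module (ZMod 2) G := AddCommGroup.zmodModule fun x => by rw [two_nsmul, hG]
  have : Finite G := Nat.finite_of_card_ne_zero (by rw [hn]; positivity)
  have h := Module.natCard_eq_pow_finrank (K := ZMod 2) (V := G)
  rw [hn, Nat.card_zmod] at h
  have hf := Nat.pow_right_injective (le_refl 2) h
  exact ⟨(LinearEquiv.ofFinrankEq G (Fin n → ZMod 2) (by rw [← hf, Module.finrank_fin_fun])).toAddEquiv⟩

/-! ### Two-torsion classes fixed by the symmetry -/

section RiemannSurface

variable {X : Type*} [TopologicalSpace X] [ChartedSpace ℂ X] {τ : X → X}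

/-- The action of a symmetry on divisor classes. -/
noncomputable def IsSymmetry.picardMap (hτ : IsSymmetry τ) : PicardGroup X →+ PicardGroup X :=
  QuotientAddGroup.map (principalDivisors X) (principalDivisors X) (divisorMap τ)
    fun _ hD => hτ.divisorMap_mem_principalDivisors hD

theorem IsSymmetry.picardMap_divisorClass (hτ : IsSymmetry τ) (D : Divisor X) :
    hτ.picardMap (divisorClass X D) = divisorClass X (divisorMap τ D) := rfl

/-- The two-torsion classes fixed by a symmetry. -/
def IsSymmetry.fixedTwoTorsion (hτ : IsSymmetry τ) : Set (PicardGroup X) :=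
  {c | c + c = 0 ∧ hτ.picardMap c = c}

end RiemannSurface

namespace HyperellipticEquation

variable {g : ℕ} {C : HyperellipticEquation g} {τ : C.Surface → C.Surface}

/-- The points $\tau(\mathrm{flip}\,p)$ and $\tau p$ lie in one fibre, so they are equal or
exchanged by the flip. If they are equal, $p$ is a Weierstrass point, and it remains to see that
$\tau p$ is one as well. -/
theorem flip_comm (hτ : Function.Involutive τ) (hconj : ∀ p, C.proj (τ p) = conjSphere (C.proj p))
    (p : C.Surface) : C.flip (τ p) = τ (C.flip p) := by
  have h1 : C.proj (τ (C.flip p)) = C.proj (τ p) := by rw [hconj, hconj, C.proj_flip]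
  rcases C.proj_eq_iff.1 h1 with h | h
  · have hp : C.flip p = p := hτ.injective h
    have h2 : C.proj (τ (C.flip (τ p))) = C.proj p := by
      rw [hconj, C.proj_flip, ← hconj, hτ p]
    rw [hp]
    refine hτ.injective ?_
    rw [hτ p]
    rcases C.proj_eq_iff.1 h2 with h3 | h3
    · exact h3
    · exact h3.trans hp
  · exact h.symm

theorem apply_eq_iff_of_flip_eq (hconj : ∀ p, C.proj (τ p) = conjSphere (C.proj p))
    {p : C.Surface} (hp : C.flip p = p) : τ p = p ↔ conjSphere (C.proj p) = C.proj p := by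
  rw [← hconj, C.proj_eq_iff, hp, or_self]

open Classical in
theorem card_weierstrass_fixed (hconj : ∀ p, C.proj (τ p) = conjSphere (C.proj p)) :
    (C.weierstrass.filter fun p => τ p = p).card =
      {e ∈ C.branchPoints | conjSphere e = e}.ncard := by
  have h : {e ∈ C.branchPoints | conjSphere e = e} =
      C.proj '' (C.weierstrass.filter fun p => τ p = p : Finset C.Surface) := by
    ext e
    simp only [Finset.coe_filter, C.mem_weierstrass, Set.mem_image, Set.mem_ofPred_eq]
    constructor
    · rintro ⟨he, hc⟩
      obtain ⟨p, hp, rfl⟩ := C.bijOn_proj.surjOn he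
      exact ⟨p, ⟨hp, (apply_eq_iff_of_flip_eq hconj hp).2 hc⟩, rfl⟩
    · rintro ⟨p, ⟨hp, hpτ⟩, rfl⟩
      exact ⟨C.bijOn_proj.mapsTo hp, (apply_eq_iff_of_flip_eq hconj hp).1 hpτ⟩
  rw [h, Set.InjOn.ncard_image, Set.ncard_coe_finset]
  refine C.bijOn_proj.injOn.mono fun p hp => ?_
  exact C.mem_weierstrass.1 (Finset.mem_filter.1 hp).1

/-- Removing two points fixed by $\tau$ leaves a basis of the two-torsion that $\tau$ permutes. -/
theorem exists_fixed_weierstrass (hconj : ∀ p, C.proj (τ p) = conjSphere (C.proj p)) {k : ℕ}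
    (hcard : {e ∈ C.branchPoints | conjSphere e = e}.ncard = 2 * k) (hk : 1 ≤ k) :
    ∃ W₀ W₁ : C.Surface, W₁ ≠ W₀ ∧ C.flip W₀ = W₀ ∧ C.flip W₁ = W₁ ∧ τ W₀ = W₀ ∧ τ W₁ = W₁ := by
  classical
  have h := card_weierstrass_fixed hconj
  rw [hcard] at h
  obtain ⟨W₁, h1, W₀, h0, hne⟩ := Finset.one_lt_card.1 (by omega :
    1 < (C.weierstrass.filter fun p => τ p = p).card)
  rw [Finset.mem_filter, C.mem_weierstrass] at h0 h1
  exact ⟨W₀, W₁, hne, h0.1, h1.1, h0.2, h1.2⟩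

theorem picardMap_pointClass (hτ : IsSymmetry τ) {W₀ : C.Surface} (h : τ W₀ = W₀) (p : C.Surface) :
    hτ.picardMap (C.pointClass W₀ p) = C.pointClass W₀ (τ p) := by
  rw [pointClass, map_sub, hτ.picardMap_divisorClass, hτ.picardMap_divisorClass,
    divisorMap_single, divisorMap_single, h, pointClass]

theorem ncard_fixedTwoTorsion (hτ : IsSymmetry τ)
    (hconj : ∀ p, C.proj (τ p) = conjSphere (C.proj p)) {k : ℕ}
    (hcard : {e ∈ C.branchPoints | conjSphere e = e}.ncard = 2 * k) (hk : 1 ≤ k) :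
    hτ.fixedTwoTorsion.ncard = 2 ^ (g + k - 1) := by
  classical
  obtain ⟨W₀, W₁, hne, h0, h1, hτ0, hτ1⟩ := exists_fixed_weierstrass hconj hcard hk
  set B := (C.weierstrass.erase W₀).erase W₁ with hB
  have hmem : ∀ {p}, p ∈ B ↔ p ≠ W₁ ∧ p ≠ W₀ ∧ C.flip p = p := fun {p} => by
    rw [hB, Finset.mem_erase, Finset.mem_erase, C.mem_weierstrass]
  have hinj : ∀ {p}, τ p ∈ B ↔ p ∈ B := fun {p} => by
    have e1 : τ p = W₁ ↔ p = W₁ := by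
      conv_lhs => rw [← hτ1]
      exact hτ.involutive.injective.eq_iff
    have e0 : τ p = W₀ ↔ p = W₀ := by
      conv_lhs => rw [← hτ0]
      exact hτ.involutive.injective.eq_iff
    rw [hmem, hmem, flip_comm hτ.involutive hconj, hτ.involutive.injective.eq_iff, ne_eq, ne_eq,
      e1, e0]
  have hW0 := C.mem_weierstrass.2 h0
  have hW1 := C.mem_weierstrass.2 h1
  have hBcard : B.card = 2 * g := by
    rw [hB, Finset.card_erase_of_mem (Finset.mem_erase.2 ⟨hne, hW1⟩),
      Finset.card_erase_of_mem hW0, C.card_weierstrass]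
    omega
  have hBfix : (B.filter fun p => τ p = p).card = 2 * k - 2 := by
    have h2 := card_weierstrass_fixed hconj
    rw [hcard] at h2
    rw [hB, Finset.filter_erase, Finset.filter_erase, Finset.card_erase_of_mem,
      Finset.card_erase_of_mem, h2]
    · omega
    · exact Finset.mem_filter.2 ⟨hW0, hτ0⟩
    · exact Finset.mem_erase.2 ⟨hne, Finset.mem_filter.2 ⟨hW1, hτ1⟩⟩
  have htwo : ∀ p ∈ B, C.pointClass W₀ p + C.pointClass W₀ p = 0 := fun p hp =>
    pointClass_add_self h0 (hmem.1 hp).2.2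
  have hsumtwo : ∀ S ⊆ B, ∑ W ∈ S, C.pointClass W₀ W + ∑ W ∈ S, C.pointClass W₀ W = 0 := by
    intro S hS
    rw [← Finset.sum_add_distrib]
    exact Finset.sum_eq_zero fun i hi => htwo i (hS hi)
  have hsuminj : ∀ S ⊆ B, ∀ S' ⊆ B,
      ∑ W ∈ S, C.pointClass W₀ W = ∑ W ∈ S', C.pointClass W₀ W → S = S' := by
    intro S hS S' hS' h
    have h2 := sum_add_sum_eq_sum_symmDiff (s := S) (t := S') fun i hi => htwo i (hS hi)
    rw [h, hsumtwo S' hS'] at h2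
    exact symmDiff_eq_bot.1 (eq_empty_of_sum_pointClass_eq_zero h0 h1 hne
      ((symmDiff_le_sup (a := S) (b := S')).trans (Finset.union_subset hS hS')) h2.symm)
  have hmap : ∀ S, hτ.picardMap (∑ W ∈ S, C.pointClass W₀ W) =
      ∑ W ∈ S.image τ, C.pointClass W₀ W := fun S => by
    rw [map_sum, Finset.sum_image hτ.involutive.injective.injOn]
    exact Finset.sum_congr rfl fun W _ => picardMap_pointClass hτ hτ0 W
  have himg : ∀ S ⊆ B, S.image τ ⊆ B := fun S hS => by
    rw [Finset.image_subset_iff]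
    exact fun W hW => hinj.2 (hS hW)
  -- Here $|B|=2g$ with $2k-2$ fixed points, so the number of orbits is $g+k-1$.
  rw [← card_invariant_powerset hτ.involutive (s := B) (m := g + k - 1)
    (fun p hp => hinj.2 hp) (by rw [hBcard, hBfix]; omega)]
  have hset : hτ.fixedTwoTorsion = (fun S => ∑ W ∈ S, C.pointClass W₀ W) ''
      (B.powerset.filter fun t => t.image τ = t : Finset (Finset C.Surface)) := by
    ext c
    simp only [Set.mem_image, Finset.coe_filter, Finset.mem_powerset, Set.mem_ofPred_eq]
    constructor
    · rintro ⟨hc, hf⟩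
      obtain ⟨S, hS, rfl⟩ := exists_sum_pointClass_eq h0 h1 hne hc
      rw [hmap] at hf
      -- By independence, a class is fixed only if the subset representing it is stable under
      -- $\tau$.
      exact ⟨S, ⟨hS, hsuminj _ (himg S hS) _ hS hf⟩, rfl⟩
    · rintro ⟨S, ⟨hS, hSτ⟩, rfl⟩
      exact ⟨hsumtwo S hS, by rw [hmap, hSτ]⟩
  rw [hset, Set.InjOn.ncard_image, Set.ncard_coe_finset]
  intro S hS S' hS' h
  simp only [Finset.coe_filter, Finset.mem_powerset, Set.mem_ofPred_eq] at hS hS'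
  exact hsuminj S hS.1 S' hS'.1 h

end HyperellipticEquation

/-! ### Spin structures and the Jacobian in terms of divisor classes -/

section RiemannSurface

variable {X : Type*} [TopologicalSpace X] [ChartedSpace ℂ X] {τ : X → X}

theorem isSpinDivisor_two_iff {K : Divisor X} (hK : IsCanonical K) {D : Divisor X} :
    IsSpinDivisor 2 D ↔ divisorClass X D + divisorClass X D = divisorClass X K := by
  rw [← map_add, ← two_nsmul]
  constructor
  · rintro ⟨K', hK', h⟩
    exact (divisorClass_eq_iff.2 h).trans (divisorClass_eq_iff.2 (hK'.linEquiv hK))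
  · exact fun h => ⟨K, hK, divisorClass_eq_iff.1 h⟩

theorem divisorClass_mem_fixedSpinStructures (hτ : IsSymmetry τ) {K : Divisor X}
    (hK : IsCanonical K) (c : PicardGroup X) :
    (show DivisorClass X from c) ∈ fixedSpinStructures 2 τ ↔
      c + c = divisorClass X K ∧ hτ.picardMap c = c := by
  constructor
  · rintro ⟨⟨D, hD, h1⟩, ⟨E, h2, hE⟩⟩
    have h1' : divisorClass X D = c := h1
    have h2' : divisorClass X E = c := h2
    refine ⟨?_, ?_⟩
    · rw [← h1']
      exact (isSpinDivisor_two_iff hK).1 hD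
    · rw [← h2', hτ.picardMap_divisorClass]
      exact divisorClass_eq_iff.2 hE
  · obtain ⟨D, rfl⟩ := divisorClass_surjective c
    rintro ⟨h1, h2⟩
    exact ⟨⟨D, (isSpinDivisor_two_iff hK).2 h1, rfl⟩, D, rfl, divisorClass_eq_iff.1 h2⟩

variable (X) in
/-- The map from the Jacobian to the divisor class group. -/
noncomputable def jacobianToPicard : Jacobian X →+ PicardGroup X :=
  QuotientAddGroup.map _ (principalDivisors X) (degreeZeroDivisors X).subtype fun _ h => h

theorem jacobianToPicard_injective : Function.Injective (jacobianToPicard X) := by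
  rw [injective_iff_map_eq_zero]
  intro j hj
  obtain ⟨D, rfl⟩ := QuotientAddGroup.mk_surjective j
  exact (QuotientAddGroup.eq_zero_iff D).2 (divisorClass_eq_zero_iff.1 hj)

theorem mem_jacobianTorsionFixed_iff (hτ : IsSymmetry τ) {j : Jacobian X} :
    j ∈ jacobianTorsionFixed 2 τ ↔ jacobianToPicard X j ∈ hτ.fixedTwoTorsion := by
  rw [jacobianTorsionFixed, AddSubgroup.mem_inf]
  refine and_congr ?_ ?_
  · rw [← map_add, ← map_zero (jacobianToPicard X), jacobianToPicard_injective.eq_iff,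
      ← two_nsmul]
    exact AddMonoidHom.mem_ker
  · constructor
    · rintro ⟨D, hD, rfl⟩
      refine divisorClass_eq_iff.2 ?_
      exact hD
    · intro h
      obtain ⟨D, rfl⟩ := QuotientAddGroup.mk_surjective j
      exact ⟨D, divisorClass_eq_iff.1 h, rfl⟩

theorem KleinSpinPair.hasDivisor (hτ : IsSymmetry τ) {m : ℕ} (A : KleinSpinPair m τ) :
    HasDivisor A.h (divisorMap τ A.D - A.D) :=
  ⟨A.isMeromorphic, fun p => by
    rw [A.order_eq, Finsupp.sub_apply, divisorMap_apply hτ.involutive]⟩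

end RiemannSurface

/-! ### Anti-holomorphic involutions on spin bundles -/

section Klein

variable {X : Type*} [TopologicalSpace X] [ChartedSpace ℂ X] [T1Space X] [CompactSpace X]
  [PreconnectedSpace X] [IsManifold 𝓘(ℂ, ℂ) ω X] {τ : X → X}

/-- Two pairs on linearly equivalent divisors are isomorphic. -/
theorem KleinSpinPair.iso_of_linEquiv (hτ : IsSymmetry τ) {m : ℕ} {A B : KleinSpinPair m τ}
    (h : LinEquiv A.D B.D) : A.Iso B := by
  obtain ⟨u, hu⟩ := h
  rcases isEmpty_or_nonempty X with hX | hX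
  · exact ⟨u, hu, eventuallyEq_codiscrete_iff.2 fun p => (IsEmpty.false p).elim⟩
  have hu' := hτ.hasDivisor_conj_comp hu
  have hA := A.hasDivisor hτ
  have hB := B.hasDivisor hτ
  -- Both sides of the intertwining relation have divisor $\tau(D_A)-D_B$, so they agree up to a
  -- constant $c$.
  have hr := (hu.mul hA).mul (hB.mul hu').inv
  have hzero : A.D - B.D + (divisorMap τ A.D - A.D) +
      -(divisorMap τ B.D - B.D + divisorMap τ (A.D - B.D)) = 0 := by
    rw [map_sub]
    abel
  rw [hzero] at hr
  obtain ⟨c, hc0, hc⟩ := hr.eq_const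
  have hev : ∀ p, ∀ᶠ q in 𝓝[≠] p, u q * A.h q = c * (B.h q * starRingEnd ℂ (u (τ q))) :=
    fun p => by
      filter_upwards [eventuallyEq_codiscrete_iff.1 hc p, (hB.mul hu').eventually_ne_zero p]
        with q h1 h2
      rw [← h1]
      simp only [Pi.mul_apply, Pi.inv_apply] at h2 ⊢
      rw [inv_mul_cancel_right₀ h2]
  -- Multiply the relation at $q$ by its conjugate at $\tau q$: the involution conditions for both
  -- pairs remove the $h$-factors, and what remains is $|c|^2=1$.
  have hnorm : c * starRingEnd ℂ c = 1 := by
    obtain ⟨p⟩ := hX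
    have ht := tendsto_nhdsNE_of_injective hτ.continuous hτ.involutive.injective p
    obtain ⟨q, h1, h2, h3, h4, h5, h6⟩ := ((hev p).and ((ht.eventually (hev (τ p))).and
      ((hu.eventually_ne_zero p).and ((hu'.eventually_ne_zero p).and
      ((eventuallyEq_codiscrete_iff.1 A.involution p).and
      (eventuallyEq_codiscrete_iff.1 B.involution p)))))).exists
    have h2' := congrArg (starRingEnd ℂ) h2
    simp only [map_mul, hτ.involutive q, Complex.conj_conj] at h2'
    have h7 : (u q * starRingEnd ℂ (u (τ q))) * (c * starRingEnd ℂ c) =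
        (u q * starRingEnd ℂ (u (τ q))) * 1 := by
      calc _ = (c * (B.h q * starRingEnd ℂ (u (τ q)))) *
            (starRingEnd ℂ c * (starRingEnd ℂ (B.h (τ q)) * u q)) := by
              linear_combination
                (-(u q * starRingEnd ℂ (u (τ q)) * c * starRingEnd ℂ c)) * h6
        _ = (u q * A.h q) * (starRingEnd ℂ (u (τ q)) * starRingEnd ℂ (A.h (τ q))) := by
              rw [h1, h2']
        _ = _ := by linear_combination (u q * starRingEnd ℂ (u (τ q))) * h5
    exact mul_left_cancel₀ (mul_ne_zero h3 h4) h7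
  -- Replacing $u$ by $lu$ changes the constant to $c\,l/\bar l$. For $l^2=c^{-1}$ one has $|l|=1$,
  -- so $lc=l^{-1}=\bar l$ and the constant becomes $1$.
  obtain ⟨l, hl⟩ := IsAlgClosed.exists_pow_nat_eq c⁻¹ (n := 2) (by norm_num)
  have hl0 : l ≠ 0 := by
    rintro rfl
    rw [zero_pow two_ne_zero] at hl
    exact inv_ne_zero hc0 hl.symm
  have hlc : l * c = starRingEnd ℂ l := by
    have hnl : ‖l‖ = 1 := by
      have h1 : ‖c‖ ^ 2 = 1 := by
        rw [Complex.mul_conj, Complex.normSq_eq_norm_sq] at hnorm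
        exact_mod_cast hnorm
      have h2 : ‖l‖ ^ 2 = ‖c‖⁻¹ := by rw [← norm_pow, hl, norm_inv]
      have h3 : ‖c‖ = 1 := (pow_eq_one_iff_of_nonneg (norm_nonneg _) two_ne_zero).1 h1
      rw [h3, inv_one] at h2
      exact (pow_eq_one_iff_of_nonneg (norm_nonneg _) two_ne_zero).1 h2
    have h4 : l * starRingEnd ℂ l = 1 := by
      rw [Complex.mul_conj, Complex.normSq_eq_norm_sq, hnl]
      norm_num
    have h5 : l ^ 2 * c = 1 := by rw [hl, inv_mul_cancel₀ hc0]
    refine mul_left_cancel₀ hl0 ?_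
    rw [h4, ← h5]
    ring
  have hlu := (HasDivisor.const (X := X) hl0).mul hu
  rw [zero_add] at hlu
  refine ⟨_, hlu, eventuallyEq_codiscrete_iff.2 fun p => ?_⟩
  filter_upwards [hev p] with q hq
  simp only [Pi.mul_apply, map_mul, ← hlc]
  linear_combination l * hq

/-- If the symmetry has a fixed point, every divisor `D` with `τ(D) ∼ D` carries an involution. -/
theorem exists_kleinSpinPair (hτ : IsSymmetry τ) {W : X} (hW : τ W = W) {m : ℕ} {D : Divisor X}
    (hD : IsSpinDivisor m D) (h : LinEquiv (divisorMap τ D) D) :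
    ∃ A : KleinSpinPair m τ, A.D = D := by
  obtain ⟨f, hf⟩ := h
  have : Nonempty X := ⟨W⟩
  -- The divisor of $f$ is $\tau(D)-D$, which $\tau$ negates. Hence $f\cdot\overline{f\circ\tau}$ is
  -- a constant $c$.
  have hN := hf.mul (hτ.hasDivisor_conj_comp hf)
  rw [map_sub, divisorMap_divisorMap hτ.involutive, ← neg_sub, neg_add_cancel] at hN
  obtain ⟨c, -, hc⟩ := hN.eq_const
  obtain ⟨v, hv0, hv⟩ := hf.exists_tendsto (p := W) (by
    rw [Finsupp.sub_apply, divisorMap_apply hτ.involutive, hW, sub_self])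
  -- At the fixed point $W$ the order of $f$ is $D(W)-D(W)=0$, and the limit $v\ne0$ there forces
  -- $c=|v|^2>0$. Positivity is what allows $f$ to be rescaled by the real number $|v|^{-1}$ so that
  -- the constant becomes $1$.
  have hcv : c = ((‖v‖ ^ 2 : ℝ) : ℂ) := by
    have ht := tendsto_nhdsNE_of_injective hτ.continuous hτ.involutive.injective W
    rw [hW] at ht
    have h1 : Tendsto (f * fun p => starRingEnd ℂ (f (τ p))) (𝓝[≠] W)
        (𝓝 (v * starRingEnd ℂ v)) :=
      hv.mul ((Complex.continuous_conj.tendsto v).comp (hv.comp ht))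
    have h2 := tendsto_nhds_unique
      (h1.congr' (eventuallyEq_codiscrete_iff.1 hc W)) tendsto_const_nhds
    rw [← h2, Complex.mul_conj, Complex.normSq_eq_norm_sq]
  have hn : (‖v‖ : ℂ) ≠ 0 := by exact_mod_cast (norm_pos_iff.2 hv0).ne'
  have hk := (HasDivisor.const (X := X) (inv_ne_zero hn)).mul hf
  rw [zero_add] at hk
  refine ⟨⟨D, hD, _, hk.1, fun p => ?_, ?_⟩, rfl⟩
  · rw [hk.2, Finsupp.sub_apply, divisorMap_apply hτ.involutive]
  · refine eventuallyEq_codiscrete_iff.2 fun p => ?_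
    filter_upwards [eventuallyEq_codiscrete_iff.1 hc p] with q hq
    simp only [Pi.mul_apply] at hq ⊢
    rw [map_mul, map_inv₀, Complex.conj_ofReal]
    calc _ = (‖v‖ : ℂ)⁻¹ * (‖v‖ : ℂ)⁻¹ * (f q * starRingEnd ℂ (f (τ q))) := by ring
      _ = 1 := by
        rw [hq, hcv]
        push_cast
        field_simp

/-- Forgetting $\beta$ is a bijection onto the fixed classes: injective by uniqueness of the
involution up to isomorphism, surjective by its existence. -/
theorem card_kleinSpinStructures (hτ : IsSymmetry τ) {W : X} (hW : τ W = W) (m : ℕ) :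
    Nat.card (KleinSpinStructures m τ) = (fixedSpinStructures m τ).ncard := by
  have hcls : ∀ {A B : KleinSpinPair m τ}, (A.D : DivisorClass X) = B.D ↔ LinEquiv A.D B.D :=
    divisorClass_eq_iff
  let φ : KleinSpinStructures m τ → DivisorClass X :=
    Quot.lift (fun A => (A.D : DivisorClass X)) fun A B ⟨u, hu, _⟩ => hcls.2 ⟨u, hu⟩
  have hφ : Function.Injective φ := by
    rintro ⟨A⟩ ⟨B⟩ h
    exact Quot.sound (KleinSpinPair.iso_of_linEquiv hτ (hcls.1 h))
  have hrange : Set.range φ = fixedSpinStructures m τ := by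
    ext c
    constructor
    · rintro ⟨⟨A⟩, rfl⟩
      exact ⟨⟨A.D, A.isSpin, rfl⟩, A.D, rfl, _, A.hasDivisor hτ⟩
    · rintro ⟨⟨E, ⟨K, hK, hEK⟩, hE⟩, D, hD, hDτ⟩
      -- The representative $E$ witnessing the spin condition and the representative $D$ witnessing
      -- invariance may differ, so the spin condition is carried over to $D$.
      have h1 : LinEquiv D E := divisorClass_eq_iff.1 (hD.trans hE.symm)
      have hspin : IsSpinDivisor m D := by
        refine ⟨K, hK, divisorClass_eq_iff.1 ?_⟩
        rw [map_nsmul, divisorClass_eq_iff.2 h1, ← map_nsmul]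
        exact divisorClass_eq_iff.2 hEK
      obtain ⟨A, hA⟩ := exists_kleinSpinPair hτ hW hspin hDτ
      refine ⟨Quot.mk _ A, ?_⟩
      rw [← hD, ← hA]
  rw [← hrange, ← Set.image_univ, hφ.injOn.ncard_image, Set.ncard_univ]

end Klein

/-! ### Reduction of the counts to fixed two-torsion -/

namespace HyperellipticEquation

variable {g : ℕ} {C : HyperellipticEquation g} {τ : C.Surface → C.Surface}

theorem ncard_fixedSpinStructures (hτ : IsSymmetry τ) {W : C.Surface} (hf : C.flip W = W)
    (hW : τ W = W) : (fixedSpinStructures 2 τ).ncard = hτ.fixedTwoTorsion.ncard := by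
  -- A $\tau$-fixed spin structure serves as base point: $2W$ is equivalent to a fibre and $g-1$
  -- fibres are canonical. Subtracting $\kappa$ identifies fixed spin structures with fixed
  -- two-torsion classes.
  set κ : PicardGroup C.Surface := (g - 1 : ℤ) • divisorClass C.Surface (Finsupp.single W 1)
    with hκ
  have hκK : κ + κ = divisorClass C.Surface ((g - 1 : ℤ) • C.fiber C.infPoint) := by
    rw [hκ, ← zsmul_add, divisorClass_single_add_single hf, map_zsmul]
  have hκτ : hτ.picardMap κ = κ := by
    rw [hκ, map_zsmul, hτ.picardMap_divisorClass, divisorMap_single, hW]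
  have h : (fixedSpinStructures 2 τ : Set (PicardGroup C.Surface)) =
      (fun c => κ + c) '' hτ.fixedTwoTorsion := by
    refine Set.ext fun (c : PicardGroup C.Surface) =>
      (divisorClass_mem_fixedSpinStructures hτ C.isCanonical_fiber c).trans ?_
    rw [← hκK]
    constructor
    · rintro ⟨h1, h2⟩
      refine ⟨c - κ, ⟨?_, ?_⟩, add_sub_cancel _ _⟩
      · rw [sub_add_sub_comm, h1, sub_self]
      · rw [map_sub, h2, hκτ]
    · rintro ⟨c, ⟨h1, h2⟩, rfl⟩
      refine ⟨?_, ?_⟩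
      · beta_reduce
        rw [add_add_add_comm, h1, add_zero]
      · beta_reduce
        rw [map_add, h2, hκτ]
  exact (congrArg Set.ncard h).trans (add_right_injective κ).injOn.ncard_image

/-- A two-torsion divisor class automatically has degree zero, so it comes from the Jacobian. -/
theorem card_jacobianTorsionFixed (hτ : IsSymmetry τ) :
    Nat.card (jacobianTorsionFixed 2 τ) = hτ.fixedTwoTorsion.ncard := by
  have h : hτ.fixedTwoTorsion = jacobianToPicard C.Surface '' (jacobianTorsionFixed 2 τ) := by
    ext c
    constructor
    · intro hc
      obtain ⟨D, rfl⟩ := divisorClass_surjective c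
      let D' : degreeZeroDivisors C.Surface := ⟨D, degree_eq_zero_of_add_self hc.1⟩
      exact ⟨QuotientAddGroup.mk D', (mem_jacobianTorsionFixed_iff hτ).2 hc, rfl⟩
    · rintro ⟨j, hj, rfl⟩
      exact (mem_jacobianTorsionFixed_iff hτ).1 hj
  rw [h, jacobianToPicard_injective.injOn.ncard_image]
  rfl

end HyperellipticEquation

end HyperellipticSpin

theorem mainTheorem7 (g k : ℕ) (C : HyperellipticEquation g)
    (hreal : ∀ n : ℕ, (C.poly.coeff n).im = 0)
    (hnonreal : ∃ z : ℂ, C.poly.IsRoot z ∧ z.im ≠ 0)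
    (hcard : {e ∈ C.branchPoints | conjSphere e = e}.ncard = 2 * k) (hk : 1 ≤ k)
    (τ : C.Surface → C.Surface) (hτ : IsSymmetry τ)
    (hconj : ∀ p, C.proj (τ p) = conjSphere (C.proj p)) :
    (fixedSpinStructures 2 τ).ncard = 2 ^ (g + k - 1) ∧
    Nonempty (jacobianTorsionFixed 2 τ ≃+ (Fin (g + k - 1) → ZMod 2)) ∧
    Nat.card (KleinSpinStructures 2 τ) = 2 ^ (g + k - 1) := by
  obtain ⟨W, _, _, hf, _, hW, _⟩ :=
    HyperellipticEquation.exists_fixed_weierstrass hconj hcard hk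
  have hT := HyperellipticEquation.ncard_fixedTwoTorsion hτ hconj hcard hk
  have h1 := (HyperellipticEquation.ncard_fixedSpinStructures hτ hf hW).trans hT
  refine ⟨h1, ?_, (card_kleinSpinStructures hτ hW 2).trans h1⟩
  refine nonempty_addEquiv_of_card (fun j => ?_)
    ((HyperellipticEquation.card_jacobianTorsionFixed hτ).trans hT)
  refine Subtype.ext (jacobianToPicard_injective ?_)
  exact (map_add _ _ _).trans (((mem_jacobianTorsionFixed_iff hτ).1 j.2).1.trans (map_zero _).symm)
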